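/- **Setting.** Fix $m$ agents, block sizes $n_1,\dots,n_m$, $n=\sum_i n_i$, and write $\theta=(\theta_1,\dots,\theta_m)\in\mathbb R^n$ with $\theta_i\in\mathbb R^{n_i}$. Agent $\ell$ has a local cost $f_\ell:\mathbb R^n\to\mathbb R$, and $f=\frac1m\sum_{\ell=1}^m f_\ell$. Assume for all $\ell$: * $f_\ell$ is differentiable, $|f_\ell(\theta)-f_\ell(\theta')|\le L^0\|\theta-\theta'\|$, $\|\nabla f_\ell(\theta)-\nabla f_\ell(\theta')\|\le L\|\theta-\theta'\|$ and $\|\nabla f_\ell(\theta)\|\le G$; * there is an oracle $F_\ell(\theta,\xi)$, jointly measurable and differentiable in $\theta$, with $\xi\in\mathbb R^s$ drawn from a law $\mathcal D_\ell$, such that $\mathbb E_\xi F_\ell(\theta,\xi)=f_\ell(\theta)$ and $\mathbb E_\xi\|\nabla F_\ell(\theta,\xi)-\nabla f_\ell(\theta)\|^2\le\sigma^2$ for all $\theta$; * agent $\ell$ has query times $T_q^\ell\subseteq\mathbb N$ and update times $T_u^\ell\subseteq\mathbb N$, and there is $D>0$ such that each of these sets meets $\{t,\dots,t+D-1\}$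 for every $t\in\mathbb N$. Let $\mathcal N_{rx}^i=\{j: f_j\text{ depends on }\theta_i\}$. **Algorithm.** Let $\mu>0$, $B\ge1$, stepsizes $\gamma_i^t>0$ and a deterministic $\theta^0$ be given. At each time $t$ a perturbation $u^t=(u_1^t,\dots,u_m^t)\sim\mathcal N(0,I_n)$ and, for each agent $i$, i.i.d. samples $\xi_i^{t,1},\dots,\xi_i^{t,B}\sim\mathcal D_i$ are drawn; the pairs $(u^t,(\xi_i^{t,j})_{i,j})$ are independent over $t$, and $u^t$ is independent of the samples. At $t\in T_q^i$ agent $i$ computes the two-point query $$\bar r_i^t=\frac1{\mu mB}\sum_{j=1}^B\bigl(F_i(\theta^t,\xi_i^{t,j})-F_i(\theta^t+\mu u^t,\xi_i^{t,j})\bigr)$$ and sends $(\bar r_i^t,t)$ to every $k$ with $i\in\mathcal N_{rx}^k$. A message arrives after a possibly random delay of at most $D$ (delay $0$ from an agent to itself) and overwrites the entry for agent $i$ in the memory of agent $k$; among messages from $i$ arriving simultaneously the newest is kept. The delays are independent of all samples and perturbations. Let $\mathcal T_i^{\ell,t}$ be the query time of agent $\ell$'s query held by agent $i$ at time $t$ (before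 the first arrival, $\mathcal T_i^{\ell,t}=0$ and the stored query value is $0$). With $\bar r_\ell$ below meaning the stored query value, $$\theta_i^{t+1}=\theta_i^t+\gamma_i^t\tilde s_i^t,\qquad \tilde s_i^t=\sum_{\ell\in\mathcal N_{rx}^i}\bar r_\ell^{\mathcal T_i^{\ell,t}}u_i^{\mathcal T_i^{\ell,t}}\ \text{ if }t\in T_u^i,\qquad \tilde s_i^t=0\ \text{ otherwise.}$$ Let $\Theta_\ell^t=(\theta^{\mathcal T_\ell^{i,t}})_{i\in\mathcal N_{rx}^\ell}$ and $\bar\Theta_\ell^t=(\theta^t)_{i\in\mathcal N_{rx}^\ell}$, vectors in $\mathbb R^{n|\mathcal N_{rx}^\ell|}$. **Theorem.** (a) If $\lim_{t\to\infty}\gamma_i^t=0$ for all $i$, then for all $\ell$: 1. $\lim_{t\to\infty}\mathbb E\|\bar\Theta_\ell^t-\Theta_\ell^t\|^2=0$; 2. $\lim_{t\to\infty}\mathbb E\bigl|f_i(\theta^t)-f_i(\theta^{\mathcal T_\ell^{i,t}})\bigr|=0$ for all $i\in\mathcal N_{rx}^\ell$. (b) Let $f$ be bounded below and $\gamma_i^t=c_i/\sqrt{t+r}$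 with $c_i>0$, $r>0$. Then for every $\mu>0$ and every integer $\bar t\ge1$ $$\min_{0\le t\le\bar t}\mathbb E\|\nabla f(\theta^t)\|^2\le C_1\mu^2+\frac{C_2\,(1+\max\{0,\log(1/\mu)\})}{\sqrt{\bar t}},$$ that is, $\mathcal O(\mu^2)+\mathcal O(1/\sqrt{\bar t})$ for each fixed $\mu$. The constants $C_1,C_2\ge0$ depend only on $m$, $(n_i)$, $s$, $B$, $D$, $L^0$, $L$, $\sigma$, $G$, $(c_i)$, $r$ and an upper bound on $f(\theta^0)-\inf f$; they depend neither on $\mu$ nor on $\bar t$. All expectations above exist and are finite. -/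

import Mathlib

open MeasureTheory ProbabilityTheory Filter Topology

universe u

noncomputable section

namespace AsyncZO

/-- The joint parameter space `ℝⁿ`, `n = n₁ + ⋯ + n_m`, with its Euclidean norm. The coordinate
`⟨i, k⟩` is the `k`-th coordinate of the local parameter vector of agent `i`. -/
abbrev Param {m : ℕ} (n : Fin m → ℕ) : Type := EuclideanSpace ℝ (Σ i : Fin m, Fin (n i))

/-- The space `ℝˢ` of sample vectors. -/
abbrev Sample (s : ℕ) : Type := EuclideanSpace ℝ (Fin s)

/-- The data of the problem and of the agents' activity: local costs `f ℓ`, stochastic zeroth-order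
oracles `F ℓ`, local data distributions `law ℓ`, query times `Tq ℓ` and update times `Tu ℓ`. -/
structure System (m : ℕ) (n : Fin m → ℕ) (s : ℕ) where
  f : Fin m → Param n → ℝ
  F : Fin m → Param n → Sample s → ℝ
  law : Fin m → Measure (Sample s)
  Tq : Fin m → Set ℕ
  Tu : Fin m → Set ℕ

variable {m s B : ℕ} {n : Fin m → ℕ}

/-- `g` depends on the parameter block of agent `i`: some change of that block alone changes
the value of `g`. -/
def DependsOn (g : Param n → ℝ) (i : Fin m) : Prop :=
  ∃ x y : Param n, (∀ p, p.1 ≠ i → x p = y p) ∧ g x ≠ g y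

/-- The global cost `f = (1/m) ∑ f_ℓ`. -/
def System.cost (S : System m n s) (x : Param n) : ℝ := (1 / (m : ℝ)) * ∑ l, S.f l x

open Classical in
/-- The neighbours from which agent `i` receives: the `j` such that `f_j` depends on `θ_i`. -/
def System.nrx (S : System m n s) (i : Fin m) : Finset (Fin m) :=
  Finset.univ.filter fun j => DependsOn (S.f j) i

/-- The assumptions on costs, oracles and activity times. -/
structure System.Regular (S : System m n s) (L₀ L σ G : ℝ) (D : ℕ) : Prop where
  law_prob : ∀ l, IsProbabilityMeasure (S.law l)
  f_diff : ∀ l, Differentiable ℝ (S.f l)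
  f_lip : ∀ l x y, |S.f l x - S.f l y| ≤ L₀ * ‖x - y‖
  f_smooth : ∀ l x y, ‖gradient (S.f l) x - gradient (S.f l) y‖ ≤ L * ‖x - y‖
  f_grad : ∀ l x, ‖gradient (S.f l) x‖ ≤ G
  F_meas : ∀ l, Measurable fun p : Param n × Sample s => S.F l p.1 p.2
  F_diff : ∀ l ξ, Differentiable ℝ fun x => S.F l x ξ
  F_int : ∀ l x, Integrable (fun ξ => S.F l x ξ) (S.law l)
  F_unbiased : ∀ l x, ∫ ξ, S.F l x ξ ∂(S.law l) = S.f l x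
  F_var_int : ∀ l x, Integrable
    (fun ξ => ‖gradient (fun y => S.F l y ξ) x - gradient (S.f l) x‖ ^ 2) (S.law l)
  F_var : ∀ l x,
    ∫ ξ, ‖gradient (fun y => S.F l y ξ) x - gradient (S.f l) x‖ ^ 2 ∂(S.law l) ≤ σ ^ 2
  query_often : ∀ l t, ∃ k, t ≤ k ∧ k < t + D ∧ k ∈ S.Tq l
  update_often : ∀ l t, ∃ k, t ≤ k ∧ k < t + D ∧ k ∈ S.Tu l

/-! ### Message passing -/

open Classical in
/-- For an agent with query times `Q` whose query of time `τ` reaches a fixed receiver with delay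
`d τ`: the query times of the messages that arrive at time `t`. -/
def arrivals (Q : Set ℕ) (d : ℕ → ℕ) (t : ℕ) : Finset ℕ :=
  (Finset.range (t + 1)).filter fun τ => τ ∈ Q ∧ τ + d τ = t

/-- The query time of the message that the receiver holds in memory at time `t` (`none` as long as
nothing has arrived). An arriving message overwrites the memory; among messages that arrive
simultaneously the newest one is kept. -/
def memory (Q : Set ℕ) (d : ℕ → ℕ) : ℕ → Option ℕ
  | 0 => if h : (arrivals Q d 0).Nonempty then some ((arrivals Q d 0).max' h) else none
  | t + 1 => if h : (arrivals Q d (t + 1)).Nonempty then some ((arrivals Q d (t + 1)).max' h)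
      else memory Q d t

/-- The timestamp of the query in memory at time `t`; its initial value is `0`. -/
def stamp (Q : Set ℕ) (d : ℕ → ℕ) (t : ℕ) : ℕ := (memory Q d t).getD 0

theorem max'_arrivals_le (Q : Set ℕ) (d : ℕ → ℕ) (t : ℕ) (h : (arrivals Q d t).Nonempty) :
    (arrivals Q d t).max' h ≤ t := by
  refine Finset.max'_le _ h _ fun y hy => ?_
  simp only [arrivals, Finset.mem_filter, Finset.mem_range] at hy
  omega

theorem stamp_le (Q : Set ℕ) (d : ℕ → ℕ) (t : ℕ) : stamp Q d t ≤ t := by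
  unfold stamp
  induction t with
  | zero =>
    rw [memory]
    split
    · exact max'_arrivals_le Q d 0 _
    · simp
  | succ t ih =>
    rw [memory]
    split
    · exact max'_arrivals_le Q d (t + 1) _
    · omega

/-! ### The algorithm -/

/-- The query value `r̄`: the two-point difference of the oracle `F` of one agent at `x` and at
`x + μ v`, each pair of evaluations sharing one sample, averaged over the minibatch `ξ`. -/
def query (F : Param n → Sample s → ℝ) (μ : ℝ) (x v : Param n) (ξ : Fin B → Sample s) : ℝ :=
  (1 / (μ * m * B)) * ∑ j, (F x (ξ j) - F (x + μ • v) (ξ j))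

open Classical in
/-- The iterates `θᵗ` on one realization of the randomness: `delay i l τ` is the delay with which
the query of agent `l` at time `τ` reaches agent `i`, `v τ` is the perturbation vector and
`ξ τ l` the minibatch of agent `l` at time `τ`. -/
def System.iterate (S : System m n s) (μ : ℝ) (γ : Fin m → ℕ → ℝ) (θ₀ : Param n)
    (delay : Fin m → Fin m → ℕ → ℕ) (v : ℕ → Param n) (ξ : ℕ → Fin m → Fin B → Sample s) :
    ℕ → Param n
  | 0 => θ₀
  | t + 1 => WithLp.toLp 2 fun p =>
      S.iterate μ γ θ₀ delay v ξ t p + γ p.1 t *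
        (if t ∈ S.Tu p.1 then
          ∑ l ∈ S.nrx p.1,
            (if (memory (S.Tq l) (delay p.1 l) t).isSome then
              query (S.F l) μ
                (S.iterate μ γ θ₀ delay v ξ (stamp (S.Tq l) (delay p.1 l) t))
                (v (stamp (S.Tq l) (delay p.1 l) t))
                (ξ (stamp (S.Tq l) (delay p.1 l) t) l)
              * v (stamp (S.Tq l) (delay p.1 l) t) p
            else 0)
        else 0)
  termination_by t => t
  decreasing_by
    · exact Nat.lt_succ_self _
    · exact Nat.lt_succ_of_le (stamp_le _ _ _)

/-- The random inputs of the algorithm: communication delays, Gaussian perturbations, samples. -/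
structure Inputs (m : ℕ) (n : Fin m → ℕ) (s B : ℕ) (Ω : Type u) where
  delay : Ω → Fin m → Fin m → ℕ → ℕ
  pert : ℕ → Ω → Param n
  samp : ℕ → Ω → Fin m → Fin B → Sample s

/-- The probabilistic assumptions on the inputs. Samples of different agents taken at the same time
may depend on each other. -/
structure Inputs.Admissible {Ω : Type u} [MeasurableSpace Ω] (N : Inputs m n s B Ω)
    (S : System m n s) (D : ℕ) (P : Measure Ω) : Prop where
  delay_meas : Measurable N.delay
  pert_meas : ∀ t, Measurable (N.pert t)
  samp_meas : ∀ t, Measurable (N.samp t)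
  delay_le : ∀ ω i l τ, l ∈ S.nrx i → N.delay ω i l τ ≤ D
  delay_self : ∀ ω i τ, N.delay ω i i τ = 0
  pert_law : ∀ t, P.map (N.pert t) = stdGaussian (Param n)
  samp_law : ∀ t l j, P.map (fun ω => N.samp t ω l j) = S.law l
  samp_batch : ∀ t l, iIndepFun (fun (j : Fin B) ω => N.samp t ω l j) P
  pert_samp : ∀ t, IndepFun (N.pert t) (N.samp t) P
  time_indep : iIndepFun (fun (t : ℕ) ω => (N.pert t ω, N.samp t ω)) P
  delay_indep : IndepFun N.delay (fun ω (t : ℕ) => (N.pert t ω, N.samp t ω)) P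

variable {Ω : Type u}

/-- The random iterate `θᵗ`. -/
def theta (S : System m n s) (N : Inputs m n s B Ω) (μ : ℝ) (γ : Fin m → ℕ → ℝ) (θ₀ : Param n)
    (t : ℕ) (ω : Ω) : Param n :=
  S.iterate μ γ θ₀ (N.delay ω) (fun τ => N.pert τ ω) (fun τ => N.samp τ ω) t

/-- The random timestamp of agent `i`'s query in the memory of agent `l` at time `t`. -/
def timestamp (S : System m n s) (N : Inputs m n s B Ω) (l i : Fin m) (t : ℕ) (ω : Ω) : ℕ :=
  stamp (S.Tq i) (N.delay ω l i) t

/-- The stacked outdated parameters of agent `l`, one copy of `ℝⁿ` per neighbour, with the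
Euclidean norm. -/
def outdated (S : System m n s) (N : Inputs m n s B Ω) (μ : ℝ) (γ : Fin m → ℕ → ℝ)
    (θ₀ : Param n) (l : Fin m) (t : ℕ) (ω : Ω) : PiLp 2 fun _ : S.nrx l => Param n :=
  WithLp.toLp 2 fun i => theta S N μ γ θ₀ (timestamp S N l i t ω) ω

/-- The current parameter, stacked once per neighbour of agent `l`. -/
def current (S : System m n s) (N : Inputs m n s B Ω) (μ : ℝ) (γ : Fin m → ℕ → ℝ)
    (θ₀ : Param n) (l : Fin m) (t : ℕ) (ω : Ω) : PiLp 2 fun _ : S.nrx l => Param n :=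
  WithLp.toLp 2 fun _ => theta S N μ γ θ₀ t ω

end AsyncZO

end

namespace AsyncZO

variable {m s B : ℕ} {n : Fin m → ℕ}

/-! ### The memory of a receiver -/

/-! The algorithm is treated as stochastic gradient descent with bounded staleness, studied for
frozen delays. For a fixed delay array the iterate at time `τ` is a function of the noise before `τ`
(`run_congr`), hence independent of the perturbation and samples of time `τ` (`indepFun_run`). The
bounds obtained are uniform over the delay arrays that occur, and the delays are independent of the
noise, so Tonelli carries the bounds over to random delays (`integral_delay_noise_le`).

Two facts about a single report carry the proof. Its second moment is bounded independently of `μ`: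
an oracle difference is the integral of a directional derivative along a segment, and the variance
bound holds at every point of that segment. The mean square is therefore of order `μ²`, which
cancels the factor `1/μ²` of the query (`lintegral_oracle_sub_sq_le`, `integral_report_sq_le`). Its
mean given the iterate is the negative partial derivative of the local cost over `m`, up to `O(μ)`:
averaging over the sample leaves the smooth `f_l`, the Gaussian covariance reproduces its linear
part, and the remainder is quadratic (`abs_integral_twoPoint_add_le`,
`abs_integral_mul_report_add_le`).

Frequent queries and bounded delays make every stored report of a neighbour at most `3D` old once
`3D` steps have passed (`memory_isSome_and_le_stamp`). Over such a window the iterates move, in mean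
square, by the order of the squared stepsize (`integral_norm_iter_sub_sq_le`). This already gives
(a).

For (b), the gradient in the descent inequality is moved back to the query time of a report, where
the report has the right mean, and then forward again; each move costs one order of the stepsize
(`integral_gradient_mul_report_le`). Local costs that do not depend on a block have zero gradient
there, so the neighbours alone rebuild the full partial derivative. Some agents may not update at a
given time, but over `D` consecutive steps each one does, so a block of `D` steps sees the whole
gradient (`le_sum_decrease`). Summing over blocks with stepsizes `a_k` of order `1/√k` gives a
weighted sum of expected squared gradients bounded by `Δ + O(μ²) ∑ a_k + O(1) ∑ a_k²`. The weights
add up to order `√T`, while `∑ a_k²` is of order `log T`. This logarithm is split into `2√T μ²` and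
`4 log⁺(1/μ)` (`log_le_mul_sq_add_posLog`): after division by `√T`, the first part joins the bias
and the second does not depend on `T`. -/

theorem mem_arrivals {Q : Set ℕ} {d : ℕ → ℕ} {t τ : ℕ} :
    τ ∈ arrivals Q d t ↔ τ ∈ Q ∧ τ + d τ = t := by
  simp only [arrivals, Finset.mem_filter, Finset.mem_range]
  constructor
  · exact fun h => h.2
  · exact fun h => ⟨by omega, h⟩

/-- The message in memory is one with the latest arrival time so far, and the memory is empty only
if nothing has arrived. -/
theorem memory_spec (Q : Set ℕ) (d : ℕ → ℕ) (t : ℕ) :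
    (∀ τ, memory Q d t = some τ →
      τ + d τ ≤ t ∧ ∀ k ∈ Q, k + d k ≤ t → k + d k ≤ τ + d τ) ∧
    (memory Q d t = none → ∀ k ∈ Q, t < k + d k) := by
  induction t with
  | zero =>
    rw [memory]
    split_ifs with h
    · refine ⟨fun τ hτ => ?_, fun h => by simp at h⟩
      have h1 := mem_arrivals.1 ((arrivals Q d 0).max'_mem h)
      simp only [Option.some.injEq] at hτ
      rw [hτ] at h1
      exact ⟨h1.2.le, fun k _ hk => by omega⟩
    · refine ⟨fun τ hτ => by simp at hτ, fun _ k hk => ?_⟩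
      by_contra hc
      exact h ⟨k, mem_arrivals.2 ⟨hk, by omega⟩⟩
  | succ t ih =>
    rw [memory]
    split_ifs with h
    · refine ⟨fun τ hτ => ?_, fun h => by simp at h⟩
      have h1 := mem_arrivals.1 ((arrivals Q d (t + 1)).max'_mem h)
      simp only [Option.some.injEq] at hτ
      rw [hτ] at h1
      exact ⟨h1.2.le, fun k _ hk => by omega⟩
    · have hne : ∀ k ∈ Q, k + d k ≠ t + 1 := fun k hk hc => h ⟨k, mem_arrivals.2 ⟨hk, hc⟩⟩
      refine ⟨fun τ hτ => ⟨((ih.1 τ hτ).1).trans (Nat.le_succ t), fun k hk hkt => ?_⟩,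
        fun hn k hk => ?_⟩
      · have := hne k hk
        exact (ih.1 τ hτ).2 k hk (by omega)
      · have := hne k hk
        have := ih.2 hn k hk
        omega

/-- With delays at most `D` and a query in each window of length `D`, the memory is filled at
time `2 D` and its content is at most `3 D` old. -/
theorem memory_isSome_and_le_stamp {Q : Set ℕ} {d : ℕ → ℕ} {D : ℕ} (hd : ∀ τ, d τ ≤ D)
    (hQ : ∀ t, ∃ k, t ≤ k ∧ k < t + D ∧ k ∈ Q) {t : ℕ} (ht : 3 * D ≤ t) :
    (memory Q d t).isSome ∧ t ≤ stamp Q d t + 3 * D := by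
  -- A query in `[t - 2D, t - D)` has arrived before `t`, so the latest arrival is at `t - 2D` or
  -- later, and that message was sent at most `D` earlier. Arrival times are compared rather than
  -- query times because messages may overtake each other.
  obtain ⟨k, hk1, hk2, hk⟩ := hQ (t - 2 * D)
  have hdk := hd k
  obtain ⟨h1, h2⟩ := memory_spec Q d t
  unfold stamp
  cases hm : memory Q d t with
  | none =>
    have := h2 hm k hk
    omega
  | some τ =>
    have h3 := (h1 τ hm).2 k hk (by omega)
    have := hd τ
    simp only [Option.isSome_some, Option.getD_some, true_and]
    omega

theorem memory_congr (Q : Set ℕ) {d d' : ℕ → ℕ} {t : ℕ} (h : ∀ τ ≤ t, d τ = d' τ) :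
    memory Q d t = memory Q d' t := by
  have ha : ∀ t' ≤ t, arrivals Q d t' = arrivals Q d' t' := by
    intro t' ht'
    ext τ
    rw [mem_arrivals, mem_arrivals]
    by_cases hτ : τ ≤ t
    · rw [h τ hτ]
    · constructor <;> intro hh <;> omega
  suffices ∀ t' ≤ t, memory Q d t' = memory Q d' t' from this t le_rfl
  intro t' ht'
  induction t' with
  | zero => simp only [memory, ha 0 ht']
  | succ k ih => simp only [memory, ha (k + 1) ht', ih (by omega)]

/-- The memory at time `t` sees only the delays of the first `t + 1` messages, so it factors through
a countable discrete space, on which every map is measurable. -/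
theorem measurable_comp_memory (Q : Set ℕ) (t : ℕ) {β : Type*} [MeasurableSpace β]
    (F : Option ℕ → β) : Measurable fun d : ℕ → ℕ => F (memory Q d t) := by
  let ext : (Fin (t + 1) → ℕ) → ℕ → ℕ := fun e τ => if h : τ < t + 1 then e ⟨τ, h⟩ else 0
  have h : (fun d : ℕ → ℕ => F (memory Q d t))
      = (fun e : Fin (t + 1) → ℕ => F (memory Q (ext e) t)) ∘ fun d i => d i := by
    funext d
    refine congrArg F (memory_congr Q fun τ hτ => ?_)
    simp only [ext]
    rw [dif_pos (by omega)]
  rw [h]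
  exact (measurable_of_countable _).comp (measurable_pi_lambda _ fun i => measurable_pi_apply _)

/-! ### Smooth functions -/

section Smooth

variable {E : Type*} [NormedAddCommGroup E] [InnerProductSpace ℝ E] [CompleteSpace E]

/-- The mean value inequality on the segment, applied to `g` minus its linearization at `x`, whose
derivative is at most `L * ‖y - x‖` there. The constant is twice the sharp one, which only affects
the final constants. -/
theorem abs_sub_sub_inner_gradient_le {g : E → ℝ} {L : ℝ} (hg : Differentiable ℝ g)
    (hL : 0 ≤ L) (h : ∀ x y, ‖gradient g x - gradient g y‖ ≤ L * ‖x - y‖) (x y : E) :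
    |g y - g x - inner ℝ (gradient g x) (y - x)| ≤ L * ‖y - x‖ ^ 2 := by
  have key := Convex.norm_image_sub_le_of_norm_hasFDerivWithin_le'
    (f := g) (f' := fun z => fderiv ℝ g z) (φ := fderiv ℝ g x) (C := L * ‖y - x‖)
    (s := segment ℝ x y) (x := x) (y := y)
    (fun z _ => (hg z).hasFDerivAt.hasFDerivWithinAt) ?_ (convex_segment x y)
    (left_mem_segment ℝ x y) (right_mem_segment ℝ x y)
  · rw [Real.norm_eq_abs] at key
    rw [inner_gradient_left]
    calc _ ≤ _ := key
      _ = _ := by ring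
  · intro z hz
    rw [← toDual_gradient, ← toDual_gradient, ← map_sub, LinearIsometryEquiv.norm_map]
    refine (h z x).trans (mul_le_mul_of_nonneg_left ?_ hL)
    rw [← dist_eq_norm, ← dist_eq_norm, dist_comm z x, dist_comm y x]
    obtain ⟨a, b, ha, hb, hab, rfl⟩ := hz
    have : a • x + b • y - x = b • (y - x) := by
      have : a = 1 - b := by linarith
      rw [this]; module
    rw [dist_comm, dist_eq_norm, this, norm_smul, dist_comm, dist_eq_norm, Real.norm_eq_abs,
      abs_of_nonneg hb]
    exact mul_le_of_le_one_left (norm_nonneg _) (by linarith)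

theorem abs_sub_le_of_norm_gradient_le {g : E → ℝ} {G : ℝ} (hg : Differentiable ℝ g)
    (h : ∀ x, ‖gradient g x‖ ≤ G) (x y : E) : |g y - g x| ≤ G * ‖y - x‖ := by
  have := Convex.norm_image_sub_le_of_norm_fderiv_le (𝕜 := ℝ) (f := g) (C := G)
    (s := Set.univ) (x := x) (y := y) (fun z _ => hg z) (fun z _ => ?_) convex_univ trivial trivial
  · exact this
  · rw [← toDual_gradient, LinearIsometryEquiv.norm_map]
    exact h z

theorem continuous_gradient {g : E → ℝ} {L : ℝ}
    (h : ∀ x y, ‖gradient g x - gradient g y‖ ≤ L * ‖x - y‖) : Continuous (gradient g) := by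
  have : LipschitzWith (Real.toNNReal L) (gradient g) := by
    refine LipschitzWith.of_dist_le_mul fun x y => ?_
    rw [dist_eq_norm, dist_eq_norm]
    exact (h x y).trans (mul_le_mul_of_nonneg_right (Real.le_coe_toNNReal L) (norm_nonneg _))
  exact this.continuous

end Smooth

/-! ### The global cost -/

theorem abs_apply_le_norm {ι : Type*} [Fintype ι] (x : EuclideanSpace ℝ ι) (p : ι) :
    |x p| ≤ ‖x‖ := by
  simpa using PiLp.norm_apply_le x p

variable {S : System m n s} {L₀ L σ G : ℝ} {D : ℕ}

/-- No signs are assumed for the constants, and degenerate dimensions permit negative ones. Passing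
to absolute values supplies the nonnegativity used by the estimates. -/
theorem System.Regular.abs (h : S.Regular L₀ L σ G D) : S.Regular |L₀| |L| σ |G| D :=
  { h with
    f_lip := fun l x y => (h.f_lip l x y).trans
      (mul_le_mul_of_nonneg_right (le_abs_self _) (norm_nonneg _))
    f_smooth := fun l x y => (h.f_smooth l x y).trans
      (mul_le_mul_of_nonneg_right (le_abs_self _) (norm_nonneg _))
    f_grad := fun l x => (h.f_grad l x).trans (le_abs_self _) }

theorem System.Regular.differentiable_cost (h : S.Regular L₀ L σ G D) :
    Differentiable ℝ S.cost := by
  unfold System.cost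
  have := h.f_diff
  fun_prop

theorem System.Regular.gradient_cost (h : S.Regular L₀ L σ G D) (x : Param n) :
    gradient S.cost x = (1 / (m : ℝ)) • ∑ l, gradient (S.f l) x := by
  refine HasGradientAt.gradient ?_
  rw [hasGradientAt_iff_hasFDerivAt]
  have h1 : ∀ l, HasFDerivAt (S.f l) (InnerProductSpace.toDual ℝ _ (gradient (S.f l) x)) x :=
    fun l => (h.f_diff l x).hasGradientAt.hasFDerivAt
  have h2 := (HasFDerivAt.fun_sum (u := Finset.univ) fun l _ => h1 l).const_mul (1 / (m : ℝ))
  rw [map_smul, map_sum]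
  exact h2

theorem System.Regular.cost_grad (h : S.Regular L₀ L σ G D) (hG : 0 ≤ G) (x : Param n) :
    ‖gradient S.cost x‖ ≤ G := by
  rw [h.gradient_cost, norm_smul]
  have h1 : ‖∑ l, gradient (S.f l) x‖ ≤ m * G := by
    refine (norm_sum_le _ _).trans ((Finset.sum_le_sum fun l _ => h.f_grad l x).trans ?_)
    simp
  rcases Nat.eq_zero_or_pos m with rfl | hm
  · simpa using hG
  · have hm' : (0 : ℝ) < m := by exact_mod_cast hm
    rw [Real.norm_of_nonneg (by positivity)]
    calc _ ≤ 1 / (m : ℝ) * (m * G) := by gcongr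
      _ = G := by field_simp

theorem System.Regular.cost_smooth (h : S.Regular L₀ L σ G D) (hL : 0 ≤ L) (x y : Param n) :
    ‖gradient S.cost x - gradient S.cost y‖ ≤ L * ‖x - y‖ := by
  rw [h.gradient_cost, h.gradient_cost, ← smul_sub, ← Finset.sum_sub_distrib, norm_smul]
  have h1 : ‖∑ l, (gradient (S.f l) x - gradient (S.f l) y)‖ ≤ m * (L * ‖x - y‖) := by
    refine (norm_sum_le _ _).trans ((Finset.sum_le_sum fun l _ => h.f_smooth l x y).trans ?_)
    simp
  rcases Nat.eq_zero_or_pos m with rfl | hm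
  · simp only [CharP.cast_eq_zero, div_zero, norm_zero, zero_mul]; positivity
  · have hm' : (0 : ℝ) < m := by exact_mod_cast hm
    rw [Real.norm_of_nonneg (by positivity)]
    calc _ ≤ 1 / (m : ℝ) * (m * (L * ‖x - y‖)) := by gcongr
      _ = _ := by field_simp

/-- Along the coordinate line through `x` in direction `p` the function is constant, so its
derivative vanishes. -/
theorem gradient_apply_eq_zero {g : Param n → ℝ} (hg : Differentiable ℝ g)
    {p : Σ i : Fin m, Fin (n i)} (hp : ¬ DependsOn g p.1) (x : Param n) :
    gradient g x p = 0 := by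
  classical
  have h1 : gradient g x p = fderiv ℝ g x (EuclideanSpace.single p 1) := by
    rw [← inner_gradient_left, EuclideanSpace.inner_single_right]
    simp
  rw [h1]
  have h2 : HasDerivAt (fun t : ℝ => g (x + t • EuclideanSpace.single p (1 : ℝ)))
      (fderiv ℝ g x (EuclideanSpace.single p 1)) 0 := by
    have := (hg x).hasFDerivAt.hasLineDerivAt (EuclideanSpace.single p (1 : ℝ))
    exact this
  have h3 : (fun t : ℝ => g (x + t • EuclideanSpace.single p (1 : ℝ))) = fun _ => g x := by
    funext t
    by_contra hc
    refine hp ⟨_, _, fun q hq => ?_, hc⟩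
    have : q ≠ p := fun h => hq (by rw [h])
    simp [this]
  rw [h3] at h2
  exact h2.unique (hasDerivAt_const _ _)

/-- The omitted terms vanish because those local costs do not depend on the block. An agent thus
loses nothing by hearing only from its neighbours. -/
theorem System.Regular.gradient_cost_apply (h : S.Regular L₀ L σ G D) (x : Param n)
    (p : Σ i : Fin m, Fin (n i)) :
    gradient S.cost x p = ∑ l ∈ S.nrx p.1, (1 / (m : ℝ)) * gradient (S.f l) x p := by
  classical
  rw [h.gradient_cost, ← Finset.mul_sum]
  have : ∑ l ∈ S.nrx p.1, gradient (S.f l) x p = ∑ l, gradient (S.f l) x p := by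
    refine Finset.sum_subset (Finset.subset_univ _) fun l _ hl => ?_
    refine gradient_apply_eq_zero (h.f_diff l) (fun hd => hl ?_) x
    simp [System.nrx, hd]
  rw [this]
  simp

end AsyncZO

namespace AsyncZO

variable {m s B : ℕ} {n : Fin m → ℕ}

/-! ### Moments of the standard Gaussian -/

section Gaussian

variable {E : Type*} [NormedAddCommGroup E] [InnerProductSpace ℝ E] [FiniteDimensional ℝ E]
  [MeasurableSpace E] [BorelSpace E]

theorem integrable_norm_pow_stdGaussian (k : ℕ) :
    Integrable (fun v : E => ‖v‖ ^ k) (stdGaussian E) := by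
  have := IsGaussian.memLp_id (stdGaussian E) (k : ENNReal) (by simp)
  exact this.integrable_norm_pow'

/-- The standard Gaussian is centred with identity covariance. This identity is how a random
direction recovers a partial derivative. -/
theorem integral_inner_mul_apply_stdGaussian {ι : Type*} [Fintype ι] (g : EuclideanSpace ℝ ι)
    (p : ι) : ∫ v, inner ℝ g v * v p ∂(stdGaussian (EuclideanSpace ℝ ι)) = g p := by
  classical
  have h := covarianceBilin_apply_eq_cov (μ := stdGaussian (EuclideanSpace ℝ ι))
    IsGaussian.memLp_two_id g (EuclideanSpace.basisFun ι ℝ p)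
  rw [covarianceBilin_stdGaussian, innerSL_apply_apply, covariance_eq_sub] at h
  · have h0 : ∫ v, inner ℝ g v ∂(stdGaussian (EuclideanSpace ℝ ι)) = 0 :=
      integral_strongDual_stdGaussian (innerSL ℝ g)
    rw [h0, zero_mul, sub_zero] at h
    simpa [EuclideanSpace.inner_single_left, EuclideanSpace.inner_single_right] using h.symm
  · exact (IsGaussian.memLp_two_id (μ := stdGaussian (EuclideanSpace ℝ ι))).const_inner g
  · exact (IsGaussian.memLp_two_id (μ := stdGaussian (EuclideanSpace ℝ ι))).const_inner _

end Gaussian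

end AsyncZO

namespace AsyncZO

variable {m s B : ℕ} {n : Fin m → ℕ}

/-! ### Second moments of oracle differences -/

theorem sq_integral_le_integral_sq {Ω : Type*} [MeasurableSpace Ω] {P : Measure Ω}
    [IsProbabilityMeasure P] {X : Ω → ℝ} (hX : MemLp X 2 P) :
    (∫ ω, X ω ∂P) ^ 2 ≤ ∫ ω, X ω ^ 2 ∂P := by
  have h1 := variance_nonneg X P
  rw [variance_eq_sub hX] at h1
  simpa using h1

/-- The fundamental theorem of calculus followed by Jensen on the unit interval. The derivative need
not be continuous or square integrable: an infinite right side makes the claim trivial, and a finite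
one yields the integrability that the fundamental theorem asks for. -/
theorem ofReal_sub_sq_le_lintegral_deriv_sq {g g' : ℝ → ℝ} (hg : ∀ t, HasDerivAt g (g' t) t)
    (hm : Measurable g') :
    ENNReal.ofReal ((g 1 - g 0) ^ 2) ≤ ∫⁻ t in Set.Ioc (0 : ℝ) 1, ENNReal.ofReal (g' t ^ 2) := by
  by_cases htop : ∫⁻ t in Set.Ioc (0 : ℝ) 1, ENNReal.ofReal (g' t ^ 2) = ⊤
  · rw [htop]; exact le_top
  have : IsProbabilityMeasure (volume.restrict (Set.Ioc (0 : ℝ) 1)) := ⟨by simp⟩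
  have hint : Integrable (fun t => g' t ^ 2) (volume.restrict (Set.Ioc (0 : ℝ) 1)) :=
    (lintegral_ofReal_ne_top_iff_integrable (by fun_prop)
      (Eventually.of_forall fun t => sq_nonneg _)).1 htop
  have h2 : MemLp g' 2 (volume.restrict (Set.Ioc (0 : ℝ) 1)) :=
    (memLp_two_iff_integrable_sq (by fun_prop)).2 hint
  have h3 : ∫ t in (0 : ℝ)..1, g' t = g 1 - g 0 :=
    intervalIntegral.integral_eq_sub_of_hasDerivAt (fun t _ => hg t)
      ((intervalIntegrable_iff_integrableOn_Ioc_of_le zero_le_one).2 (h2.integrable (by simp)))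
  rw [← h3, intervalIntegral.integral_of_le zero_le_one,
    ← ofReal_integral_eq_lintegral_ofReal hint (Eventually.of_forall fun t => sq_nonneg _)]
  exact ENNReal.ofReal_le_ofReal (sq_integral_le_integral_sq h2)

variable {S : System m n s} {L₀ L σ G : ℝ} {D : ℕ}

/-- Splitting the oracle gradient into its deviation from the true gradient and the true gradient
itself gives one term controlled by `σ` and one by `G`. -/
theorem System.Regular.lintegral_gradient_sq_le (h : S.Regular L₀ L σ G D) (l : Fin m)
    (z w : Param n) :
    ∫⁻ ξ, ENNReal.ofReal ((inner ℝ (gradient (fun y => S.F l y ξ) z) w) ^ 2) ∂(S.law l)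
      ≤ ENNReal.ofReal ((2 * σ ^ 2 + 2 * G ^ 2) * ‖w‖ ^ 2) := by
  have := h.law_prob l
  have hle : ∀ ξ, (inner ℝ (gradient (fun y => S.F l y ξ) z) w) ^ 2 ≤
      (2 * ‖gradient (fun y => S.F l y ξ) z - gradient (S.f l) z‖ ^ 2 + 2 * G ^ 2)
        * ‖w‖ ^ 2 := by
    intro ξ
    set a := gradient (fun y => S.F l y ξ) z
    set b := gradient (S.f l) z
    have h1 : (inner ℝ a w) ^ 2 ≤ (‖a‖ * ‖w‖) ^ 2 := by
      rw [← sq_abs]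
      exact pow_le_pow_left₀ (abs_nonneg _) (abs_real_inner_le_norm a w) 2
    have h2 : ‖a‖ ≤ ‖a - b‖ + G := by
      have := norm_add_le (a - b) b
      rw [sub_add_cancel] at this
      exact this.trans (by gcongr; exact h.f_grad l z)
    have h3 : ‖a‖ ^ 2 ≤ 2 * ‖a - b‖ ^ 2 + 2 * G ^ 2 := by
      have := pow_le_pow_left₀ (norm_nonneg _) h2 2
      nlinarith [sq_nonneg (‖a - b‖ - G)]
    rw [mul_pow] at h1
    exact h1.trans (by gcongr)
  have hint : Integrable (fun ξ => (2 * ‖gradient (fun y => S.F l y ξ) z - gradient (S.f l) z‖ ^ 2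
      + 2 * G ^ 2) * ‖w‖ ^ 2) (S.law l) :=
    (((h.F_var_int l z).const_mul 2).add (integrable_const _)).mul_const _
  calc _ ≤ ∫⁻ ξ, ENNReal.ofReal ((2 * ‖gradient (fun y => S.F l y ξ) z - gradient (S.f l) z‖ ^ 2
      + 2 * G ^ 2) * ‖w‖ ^ 2) ∂(S.law l) :=
        lintegral_mono fun ξ => ENNReal.ofReal_le_ofReal (hle ξ)
    _ = ENNReal.ofReal (∫ ξ, (2 * ‖gradient (fun y => S.F l y ξ) z - gradient (S.f l) z‖ ^ 2
      + 2 * G ^ 2) * ‖w‖ ^ 2 ∂(S.law l)) :=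
        (ofReal_integral_eq_lintegral_ofReal hint
          (Eventually.of_forall fun ξ => by positivity)).symm
    _ ≤ _ := by
        refine ENNReal.ofReal_le_ofReal ?_
        rw [integral_mul_const, integral_add ((h.F_var_int l z).const_mul 2) (integrable_const _),
          integral_const_mul]
        have := h.F_var l z
        simp only [integral_const, probReal_univ, smul_eq_mul, one_mul]
        gcongr

/-- The derivative is a pointwise limit of jointly measurable difference quotients. This supplies
the joint measurability needed for Tonelli on segment and sample. -/
theorem measurable_uncurry_of_hasDerivAt {α : Type*} [MeasurableSpace α] {f k : ℝ → α → ℝ}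
    (hf : Measurable (Function.uncurry f)) (hk : ∀ t a, HasDerivAt (fun t => f t a) (k t a) t) :
    Measurable (Function.uncurry k) := by
  refine measurable_of_tendsto_metrizable (f := fun (j : ℕ) (p : ℝ × α) =>
    ((j : ℝ) + 1) * (f (p.1 + ((j : ℝ) + 1)⁻¹) p.2 - f p.1 p.2)) (fun j => ?_) ?_
  · refine measurable_const.mul (Measurable.sub ?_ hf)
    exact hf.comp (f := fun p : ℝ × α => (p.1 + ((j : ℝ) + 1)⁻¹, p.2)) (by fun_prop)
  · rw [tendsto_pi_nhds]
    rintro ⟨t, a⟩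
    have h2 : Tendsto (fun j : ℕ => ((j : ℝ) + 1)⁻¹) atTop (𝓝[≠] 0) := by
      refine tendsto_nhdsWithin_iff.2 ⟨?_, Eventually.of_forall fun j => ?_⟩
      · simpa [one_div] using tendsto_one_div_add_atTop_nhds_zero_nat (𝕜 := ℝ)
      · have : (0 : ℝ) < ((j : ℝ) + 1)⁻¹ := by positivity
        exact this.ne'
    have h3 := (hk t a).tendsto_slope_zero.comp h2
    simpa [Function.comp_def] using h3

/-- The gradient bound holds in mean at each fixed point, not uniformly in the sample. The
difference is therefore first bounded by an integral over the segment, and Tonelli then puts the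
mean over the sample inside. -/
theorem System.Regular.lintegral_oracle_sub_sq_le (h : S.Regular L₀ L σ G D) (l : Fin m)
    (x y : Param n) :
    ∫⁻ ξ, ENNReal.ofReal ((S.F l x ξ - S.F l y ξ) ^ 2) ∂(S.law l)
      ≤ ENNReal.ofReal ((2 * σ ^ 2 + 2 * G ^ 2) * ‖x - y‖ ^ 2) := by
  have := h.law_prob l
  obtain ⟨w, hw⟩ : ∃ w, w = x - y := ⟨_, rfl⟩
  rw [← hw]
  obtain ⟨k, hkdef⟩ : ∃ k : ℝ → Sample s → ℝ, ∀ t ξ, k t ξ =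
    inner ℝ (gradient (fun z => S.F l z ξ) (y + t • w)) w := ⟨_, fun _ _ => rfl⟩
  have hk : ∀ t ξ, HasDerivAt (fun t : ℝ => S.F l (y + t • w) ξ) (k t ξ) t := by
    intro t ξ
    have h1 := (h.F_diff l ξ (y + t • w)).hasFDerivAt
    have h2 : HasDerivAt (fun t : ℝ => y + t • w) w t := by
      simpa using ((hasDerivAt_id t).smul_const w).const_add y
    rw [hkdef, inner_gradient_left]
    exact h1.comp_hasDerivAt t h2
  have hkm : Measurable (Function.uncurry k) := by
    refine measurable_uncurry_of_hasDerivAt ?_ hk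
    exact (h.F_meas l).comp (f := fun p : ℝ × Sample s => (y + p.1 • w, p.2)) (by fun_prop)
  calc _ ≤ ∫⁻ ξ, (∫⁻ t in Set.Ioc (0 : ℝ) 1, ENNReal.ofReal (k t ξ ^ 2)) ∂(S.law l) := by
        refine lintegral_mono fun ξ => ?_
        have h1 := ofReal_sub_sq_le_lintegral_deriv_sq (fun t => hk t ξ)
          (hkm.comp (measurable_id.prodMk measurable_const))
        rw [one_smul, zero_smul, add_zero, hw, add_sub_cancel] at h1
        exact h1
    _ = ∫⁻ t in Set.Ioc (0 : ℝ) 1, ∫⁻ ξ, ENNReal.ofReal (k t ξ ^ 2) ∂(S.law l) := by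
        refine lintegral_lintegral_swap ?_
        have : Measurable fun p : Sample s × ℝ => k p.2 p.1 := hkm.comp measurable_swap
        exact (ENNReal.measurable_ofReal.comp (this.pow_const 2)).aemeasurable
    _ ≤ ∫⁻ t in Set.Ioc (0 : ℝ) 1, ENNReal.ofReal ((2 * σ ^ 2 + 2 * G ^ 2) * ‖w‖ ^ 2) := by
        refine lintegral_mono fun t => ?_
        simp_rw [hkdef]
        exact h.lintegral_gradient_sq_le l _ _
    _ = _ := by simp

/-- The integrand of the two-point estimator in direction `p`. -/
def System.twoPoint (S : System m n s) (μ : ℝ) (l : Fin m) (p : Σ i : Fin m, Fin (n i))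
    (z : Param n × Param n × Sample s) : ℝ :=
  (S.F l z.1 z.2.2 - S.F l (z.1 + μ • z.2.1) z.2.2) * z.2.1 p

theorem System.Regular.measurable_twoPoint (h : S.Regular L₀ L σ G D) (μ : ℝ) (l : Fin m)
    (p : Σ i : Fin m, Fin (n i)) : Measurable (S.twoPoint μ l p) := by
  unfold System.twoPoint
  refine (Measurable.sub ?_ ?_).mul (by fun_prop)
  · exact (h.F_meas l).comp (f := fun z : Param n × Param n × Sample s => (z.1, z.2.2))
      (by fun_prop)
  · exact (h.F_meas l).comp (f := fun z : Param n × Param n × Sample s =>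
      (z.1 + μ • z.2.1, z.2.2)) (by fun_prop)

/-- The `k`-th moment of the norm of a standard Gaussian vector. -/
noncomputable def gaussMoment (n : Fin m → ℕ) (k : ℕ) : ℝ :=
  ∫ v, ‖v‖ ^ k ∂(stdGaussian (Param n))

theorem gaussMoment_nonneg (n : Fin m → ℕ) (k : ℕ) : 0 ≤ gaussMoment n k :=
  integral_nonneg fun _ => by positivity

/-- Two powers of `‖v‖` come from the displacement `μ • v` and two from the factor `v p`, hence the
fourth moment. The factor `μ²` is what later cancels the normalization of the query. -/
theorem System.Regular.lintegral_twoPoint_sq_le (h : S.Regular L₀ L σ G D) (μ : ℝ) (l : Fin m)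
    (p : Σ i : Fin m, Fin (n i)) (x : Param n) :
    ∫⁻ z, ENNReal.ofReal (S.twoPoint μ l p (x, z) ^ 2) ∂((stdGaussian (Param n)).prod (S.law l))
      ≤ ENNReal.ofReal ((2 * σ ^ 2 + 2 * G ^ 2) * μ ^ 2 * gaussMoment n 4) := by
  have := h.law_prob l
  have hm : Measurable fun z : Param n × Sample s => ENNReal.ofReal (S.twoPoint μ l p (x, z) ^ 2) :=
    ENNReal.measurable_ofReal.comp
      (((h.measurable_twoPoint μ l p).comp (measurable_const.prodMk measurable_id)).pow_const 2)
  rw [lintegral_prod _ hm.aemeasurable]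
  calc _ ≤ ∫⁻ v, ENNReal.ofReal ((2 * σ ^ 2 + 2 * G ^ 2) * μ ^ 2 * ‖v‖ ^ 4)
        ∂(stdGaussian (Param n)) := by
        refine lintegral_mono fun v => ?_
        have h1 : ∀ ξ, ENNReal.ofReal (S.twoPoint μ l p (x, v, ξ) ^ 2)
            = ENNReal.ofReal (v p ^ 2) *
              ENNReal.ofReal ((S.F l x ξ - S.F l (x + μ • v) ξ) ^ 2) := by
          intro ξ
          rw [← ENNReal.ofReal_mul (sq_nonneg _)]
          congr 1
          simp only [System.twoPoint]
          ring
        simp_rw [h1]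
        rw [lintegral_const_mul' _ _ ENNReal.ofReal_ne_top]
        refine (mul_le_mul_right (h.lintegral_oracle_sub_sq_le l x (x + μ • v)) _).trans ?_
        rw [← ENNReal.ofReal_mul (sq_nonneg _)]
        refine ENNReal.ofReal_le_ofReal ?_
        have h2 : x - (x + μ • v) = -(μ • v) := by abel
        have h3 : v p ^ 2 ≤ ‖v‖ ^ 2 := by
          rw [← sq_abs]
          exact pow_le_pow_left₀ (abs_nonneg _) (abs_apply_le_norm v p) 2
        rw [h2, norm_neg, norm_smul, mul_pow, Real.norm_eq_abs, sq_abs]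
        calc _ ≤ ‖v‖ ^ 2 * ((2 * σ ^ 2 + 2 * G ^ 2) * (μ ^ 2 * ‖v‖ ^ 2)) := by gcongr
          _ = _ := by ring
    _ = _ := by
        rw [← ofReal_integral_eq_lintegral_ofReal
          ((integrable_norm_pow_stdGaussian 4).const_mul _)
          (Eventually.of_forall fun v => by positivity), integral_const_mul]
        rfl

theorem memLp_two_of_lintegral_sq_le {Ω : Type*} [MeasurableSpace Ω] {P : Measure Ω} {X : Ω → ℝ}
    (hX : AEStronglyMeasurable X P) {c : ℝ}
    (hc : ∫⁻ ω, ENNReal.ofReal (X ω ^ 2) ∂P ≤ ENNReal.ofReal c) : MemLp X 2 P := by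
  rw [memLp_two_iff_integrable_sq hX]
  exact (lintegral_ofReal_ne_top_iff_integrable (hX.pow 2)
      (Eventually.of_forall fun t => sq_nonneg _)).1 (hc.trans_lt ENNReal.ofReal_lt_top).ne

theorem integral_sq_le_of_lintegral_sq_le {Ω : Type*} [MeasurableSpace Ω] {P : Measure Ω}
    {X : Ω → ℝ} (hX : AEStronglyMeasurable X P) {c : ℝ} (hc0 : 0 ≤ c)
    (hc : ∫⁻ ω, ENNReal.ofReal (X ω ^ 2) ∂P ≤ ENNReal.ofReal c) : ∫ ω, X ω ^ 2 ∂P ≤ c := by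
  rw [integral_eq_lintegral_of_nonneg_ae (Eventually.of_forall fun t => sq_nonneg _) (hX.pow 2)]
  exact ENNReal.toReal_le_of_le_ofReal hc0 hc

theorem System.Regular.memLp_twoPoint (h : S.Regular L₀ L σ G D) (μ : ℝ) (l : Fin m)
    (p : Σ i : Fin m, Fin (n i)) (x : Param n) :
    MemLp (fun z => S.twoPoint μ l p (x, z)) 2 ((stdGaussian (Param n)).prod (S.law l)) :=
  memLp_two_of_lintegral_sq_le ((h.measurable_twoPoint μ l p).comp
    (measurable_const.prodMk measurable_id)).aestronglyMeasurable
    (h.lintegral_twoPoint_sq_le μ l p x)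

/-- The two-point estimator has a bias of order `μ²`. -/
theorem System.Regular.abs_integral_twoPoint_add_le (h : S.Regular L₀ L σ G D) (hL : 0 ≤ L)
    (μ : ℝ) (l : Fin m) (p : Σ i : Fin m, Fin (n i)) (x : Param n) :
    |∫ z, S.twoPoint μ l p (x, z) ∂((stdGaussian (Param n)).prod (S.law l))
      + μ * gradient (S.f l) x p| ≤ L * μ ^ 2 * gaussMoment n 3 := by
  have := h.law_prob l
  have hint := (h.memLp_twoPoint μ l p x).integrable (by simp)
  rw [integral_prod _ hint]
  -- Integrating the sample out first replaces the oracle by `f l`, for which a Lipschitz gradient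
  -- is available.
  have h1 : ∀ v, ∫ ξ, S.twoPoint μ l p (x, v, ξ) ∂(S.law l)
      = (S.f l x - S.f l (x + μ • v)) * v p := by
    intro v
    simp only [System.twoPoint]
    rw [integral_mul_const, integral_sub (h.F_int l _) (h.F_int l _), h.F_unbiased, h.F_unbiased]
  have hint2 := hint.integral_prod_left
  simp_rw [h1] at hint2 ⊢
  have hi3 : Integrable (fun v => inner ℝ (gradient (S.f l) x) v * v p)
      (stdGaussian (Param n)) := by
    refine ((integrable_norm_pow_stdGaussian 2).const_mul ‖gradient (S.f l) x‖).mono'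
      (by fun_prop) (Eventually.of_forall fun v => ?_)
    rw [norm_mul, Real.norm_eq_abs, Real.norm_eq_abs]
    calc _ ≤ (‖gradient (S.f l) x‖ * ‖v‖) * ‖v‖ := by
          gcongr
          · exact abs_real_inner_le_norm _ _
          · exact abs_apply_le_norm v p
      _ = _ := by ring
  -- The partial derivative is written as a Gaussian integral so that the linear terms cancel under
  -- a single integral, leaving only the quadratic remainder.
  rw [← integral_inner_mul_apply_stdGaussian (gradient (S.f l) x) p, ← integral_const_mul,
    ← integral_add hint2 (hi3.const_mul μ)]
  calc _ ≤ ∫ v, ‖(S.f l x - S.f l (x + μ • v)) * v p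
        + μ * (inner ℝ (gradient (S.f l) x) v * v p)‖ ∂(stdGaussian (Param n)) :=
        norm_integral_le_integral_norm _
    _ ≤ ∫ v, L * μ ^ 2 * ‖v‖ ^ 3 ∂(stdGaussian (Param n)) := by
        refine integral_mono (hint2.add (hi3.const_mul μ)).norm
          ((integrable_norm_pow_stdGaussian 3).const_mul _) fun v => ?_
        have h2 := abs_sub_sub_inner_gradient_le (h.f_diff l) hL (h.f_smooth l) x (x + μ • v)
        have h3 : x + μ • v - x = μ • v := by abel
        rw [h3, inner_smul_right, norm_smul, mul_pow, Real.norm_eq_abs, sq_abs] at h2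
        have h4 : (S.f l x - S.f l (x + μ • v)) * v p
            + μ * (inner ℝ (gradient (S.f l) x) v * v p)
            = -((S.f l (x + μ • v) - S.f l x - μ * inner ℝ (gradient (S.f l) x) v) * v p) := by
          ring
        simp only
        rw [h4, norm_neg, norm_mul, Real.norm_eq_abs, Real.norm_eq_abs]
        calc _ ≤ (L * (μ ^ 2 * ‖v‖ ^ 2)) * ‖v‖ := by
              gcongr
              exact abs_apply_le_norm v p
          _ = _ := by ring
    _ = _ := by rw [integral_const_mul]; rfl

end AsyncZO

namespace AsyncZO

variable {m s B : ℕ} {n : Fin m → ℕ}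

/-! ### The iterates as a function of the delays and of the noise -/

/-- The perturbations and samples of all times. -/
abbrev Noise (m : ℕ) (n : Fin m → ℕ) (s B : ℕ) : Type :=
  ℕ → Param n × (Fin m → Fin B → Sample s)

/-- The communication delays of all messages. -/
abbrev Delays (m : ℕ) : Type := Fin m → Fin m → ℕ → ℕ

/-- The iterate at time `t` for given delays and noise. -/
noncomputable def System.run (S : System m n s) (μ : ℝ) (γ : Fin m → ℕ → ℝ) (θ₀ : Param n) (t : ℕ)
    (d : Delays m) (w : Noise m n s B) : Param n :=
  S.iterate μ γ θ₀ d (fun τ => (w τ).1) (fun τ => (w τ).2) t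

/-- The coordinate `p` of the stochastic descent direction given by agent `l`'s query of time `τ`. -/
noncomputable def System.report (S : System m n s) (μ : ℝ) (γ : Fin m → ℕ → ℝ) (θ₀ : Param n)
    (l : Fin m) (p : Σ i : Fin m, Fin (n i)) (τ : ℕ) (d : Delays m) (w : Noise m n s B) : ℝ :=
  query (S.F l) μ (S.run μ γ θ₀ τ d w) (w τ).1 ((w τ).2 l) * (w τ).1 p

variable (S : System m n s) (μ : ℝ) (γ : Fin m → ℕ → ℝ) (θ₀ : Param n)

open Classical in
/-- The coordinate `p` of the update direction at time `t`. -/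
noncomputable def System.direction (p : Σ i : Fin m, Fin (n i)) (t : ℕ) (d : Delays m)
    (w : Noise m n s B) : ℝ :=
  if t ∈ S.Tu p.1 then ∑ l ∈ S.nrx p.1,
    (if (memory (S.Tq l) (d p.1 l) t).isSome then
      S.report μ γ θ₀ l p (stamp (S.Tq l) (d p.1 l) t) d w else 0)
  else 0

theorem System.run_zero (d : Delays m) (w : Noise m n s B) : S.run μ γ θ₀ 0 d w = θ₀ := by
  unfold System.run
  rw [System.iterate]

theorem System.run_succ_apply (t : ℕ) (d : Delays m) (w : Noise m n s B)
    (p : Σ i : Fin m, Fin (n i)) :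
    S.run μ γ θ₀ (t + 1) d w p
      = S.run μ γ θ₀ t d w p + γ p.1 t * S.direction μ γ θ₀ p t d w := by
  unfold System.run
  rw [System.iterate]
  rfl

/-- Step `t` reads reports stamped at most `t`, so the iterate at `t + 1` uses no noise later than
`t`. With the delays frozen this gives independence of an iterate from the noise of its own time. -/
theorem System.run_congr {t : ℕ} (d : Delays m) {w w' : Noise m n s B}
    (h : ∀ τ < t, w τ = w' τ) : S.run μ γ θ₀ t d w = S.run μ γ θ₀ t d w' := by
  induction t using Nat.strong_induction_on with
  | _ t ih =>
    cases t with
    | zero => rw [System.run_zero, System.run_zero]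
    | succ t =>
      ext p
      rw [System.run_succ_apply, System.run_succ_apply,
        ih t (Nat.lt_succ_self t) fun τ hτ => h τ (by omega)]
      congr 2
      unfold System.direction
      have hr : ∀ l, S.report μ γ θ₀ l p (stamp (S.Tq l) (d p.1 l) t) d w
          = S.report μ γ θ₀ l p (stamp (S.Tq l) (d p.1 l) t) d w' := by
        intro l
        have hle := stamp_le (S.Tq l) (d p.1 l) t
        unfold System.report
        rw [ih _ (by omega) fun τ hτ => h τ (by omega), h _ (by omega)]
      simp only [hr]

variable {S} {L₀ L σ G : ℝ} {D : ℕ}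

theorem System.Regular.measurable_query (h : S.Regular L₀ L σ G D) (l : Fin m) :
    Measurable fun z : Param n × Param n × (Fin B → Sample s) =>
      query (S.F l) μ z.1 z.2.1 z.2.2 := by
  unfold query
  refine measurable_const.mul (Finset.measurable_fun_sum _ fun j _ => Measurable.sub ?_ ?_)
  · exact (h.F_meas l).comp (f := fun z : Param n × Param n × (Fin B → Sample s) =>
      (z.1, z.2.2 j)) (by fun_prop)
  · exact (h.F_meas l).comp (f := fun z : Param n × Param n × (Fin B → Sample s) =>
      (z.1 + μ • z.2.1, z.2.2 j)) (by fun_prop)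

theorem System.Regular.measurable_report_of_run (h : S.Regular L₀ L σ G D) {τ : ℕ}
    (hrun : Measurable fun z : Delays m × Noise m n s B => S.run μ γ θ₀ τ z.1 z.2)
    (l : Fin m) (p : Σ i : Fin m, Fin (n i)) :
    Measurable fun z : Delays m × Noise m n s B => S.report μ γ θ₀ l p τ z.1 z.2 := by
  unfold System.report
  refine Measurable.mul ?_ (by fun_prop)
  refine (h.measurable_query μ l).comp (f := fun z : Delays m × Noise m n s B =>
    (S.run μ γ θ₀ τ z.1 z.2, (z.2 τ).1, (z.2 τ).2 l)) ?_
  exact hrun.prodMk (by fun_prop)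

/-- A timestamp at time `t` takes only the values up to `t`, so evaluation at this random index is a
finite sum over its level sets. -/
theorem measurable_stamp_comp (Q : Set ℕ) (t : ℕ) (i l : Fin m) {β : Type*} [MeasurableSpace β]
    [AddCommMonoid β] [MeasurableAdd₂ β] {g : ℕ → Delays m × Noise m n s B → β}
    (hg : ∀ τ ≤ t, Measurable (g τ)) :
    Measurable fun z : Delays m × Noise m n s B => g (stamp Q (z.1 i l) t) z := by
  classical
  have hrepr : (fun z : Delays m × Noise m n s B => g (stamp Q (z.1 i l) t) z)
      = fun z => ∑ τ ∈ Finset.range (t + 1), if stamp Q (z.1 i l) t = τ then g τ z else 0 := by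
    funext z
    rw [Finset.sum_ite_eq, if_pos]
    have := stamp_le Q (z.1 i l) t
    simp only [Finset.mem_range]
    omega
  rw [hrepr]
  refine Finset.measurable_fun_sum _ fun τ hτ => Measurable.ite ?_ (hg τ ?_) measurable_const
  · have h1 : Measurable fun d : ℕ → ℕ => stamp Q d t :=
      measurable_comp_memory Q t fun o => o.getD 0
    have h2 : Measurable fun z : Delays m × Noise m n s B => stamp Q (z.1 i l) t :=
      h1.comp (by fun_prop)
    exact h2 (measurableSet_singleton τ)
  · simp only [Finset.mem_range] at hτ
    omega

theorem System.Regular.measurable_run (h : S.Regular L₀ L σ G D) (t : ℕ) :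
    Measurable fun z : Delays m × Noise m n s B => S.run μ γ θ₀ t z.1 z.2 := by
  induction t using Nat.strong_induction_on with
  | _ t ih =>
    cases t with
    | zero => simp only [System.run_zero]; exact measurable_const
    | succ t =>
      have h1 : ∀ p, Measurable fun z : Delays m × Noise m n s B =>
          S.run μ γ θ₀ (t + 1) z.1 z.2 p := by
        intro p
        simp only [System.run_succ_apply, System.direction]
        have h0 : Measurable fun z : Delays m × Noise m n s B => S.run μ γ θ₀ t z.1 z.2 p :=
          (by fun_prop : Measurable fun x : Param n => x p).comp (ih t (Nat.lt_succ_self t))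
        refine h0.add (measurable_const.mul ?_)
        split_ifs
        · refine Finset.measurable_fun_sum _ fun l _ => Measurable.ite ?_ ?_ measurable_const
          · have h2 : Measurable fun d : ℕ → ℕ => (memory (S.Tq l) d t).isSome :=
              measurable_comp_memory _ t Option.isSome
            have h3 : Measurable fun z : Delays m × Noise m n s B =>
              (memory (S.Tq l) (z.1 p.1 l) t).isSome := h2.comp (by fun_prop)
            exact h3 (measurableSet_singleton true)
          · exact measurable_stamp_comp (S.Tq l) t p.1 l
              (g := fun τ z => S.report μ γ θ₀ l p τ z.1 z.2) fun τ hτ =>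
              h.measurable_report_of_run μ γ θ₀ (ih τ (by omega)) l p
        · exact measurable_const
      have h4 : (fun z : Delays m × Noise m n s B => S.run μ γ θ₀ (t + 1) z.1 z.2)
          = fun z => WithLp.toLp 2 fun p => S.run μ γ θ₀ (t + 1) z.1 z.2 p := rfl
      rw [h4]
      exact (by fun_prop : Measurable (WithLp.toLp 2 : (_ → ℝ) → Param n)).comp
        (measurable_pi_lambda _ h1)

theorem System.Regular.measurable_report (h : S.Regular L₀ L σ G D) (l : Fin m)
    (p : Σ i : Fin m, Fin (n i)) (τ : ℕ) :
    Measurable fun z : Delays m × Noise m n s B => S.report μ γ θ₀ l p τ z.1 z.2 :=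
  h.measurable_report_of_run μ γ θ₀ (h.measurable_run μ γ θ₀ τ) l p

/-! ### Independence of the noise and of the past -/

variable {Ω : Type u} [MeasurableSpace Ω] {P : Measure Ω}

/-- The noise of one realization. -/
def Inputs.noise (N : Inputs m n s B Ω) (ω : Ω) : Noise m n s B :=
  fun t => (N.pert t ω, N.samp t ω)

variable {N : Inputs m n s B Ω}

theorem Inputs.Admissible.measurable_noise (hN : N.Admissible S D P) : Measurable N.noise :=
  measurable_pi_lambda _ fun t => (hN.pert_meas t).prodMk (hN.samp_meas t)

theorem System.Regular.measurable_run_noise (h : S.Regular L₀ L σ G D)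
    (hN : N.Admissible S D P) (d : Delays m) (t : ℕ) :
    Measurable fun ω => S.run μ γ θ₀ t d (N.noise ω) :=
  (h.measurable_run μ γ θ₀ t).comp (measurable_const.prodMk hN.measurable_noise)

theorem System.Regular.indepFun_run (h : S.Regular L₀ L σ G D) (hN : N.Admissible S D P)
    (d : Delays m) (t : ℕ) :
    IndepFun (fun ω => S.run μ γ θ₀ t d (N.noise ω)) (fun ω => N.noise ω t) P := by
  classical
  have h1 := iIndepFun.indepFun_finset (Finset.range t) {t} (by simp) hN.time_indep
    fun k => (hN.pert_meas k).prodMk (hN.samp_meas k)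
  -- The past noise is extended by the arbitrary value `(0, 0)` from time `t` on; by `run_congr` the
  -- iterate does not see it.
  let φ : (Finset.range t → Param n × (Fin m → Fin B → Sample s)) → Noise m n s B :=
    fun e τ => if hτ : τ ∈ Finset.range t then e ⟨τ, hτ⟩ else (0, 0)
  have hφ : Measurable φ := by
    refine measurable_pi_lambda _ fun τ => ?_
    by_cases hτ : τ ∈ Finset.range t
    · simp only [φ, dif_pos hτ]; fun_prop
    · simp only [φ, dif_neg hτ]; exact measurable_const
  have hφ' : Measurable fun e => S.run μ γ θ₀ t d (φ e) :=
    (h.measurable_run μ γ θ₀ t).comp (measurable_const.prodMk hφ)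
  have hψ : Measurable fun e : ({t} : Finset ℕ) → Param n × (Fin m → Fin B → Sample s) =>
      e ⟨t, Finset.mem_singleton_self t⟩ := measurable_pi_apply _
  have h2 := h1.comp hφ' hψ
  convert h2 using 1
  · funext ω
    refine S.run_congr μ γ θ₀ d fun τ hτ => ?_
    simp [φ, hτ, Inputs.noise]
  · rfl

/-- The iterate is independent of the noise of its own time, and there the perturbation is
independent of the samples. With this product law, moments of a query reduce to integrals at a
frozen point `x`. -/
theorem System.Regular.map_run_pert_samp (h : S.Regular L₀ L σ G D) (hN : N.Admissible S D P)
    [IsProbabilityMeasure P] (d : Delays m) (t : ℕ) (l : Fin m) (j : Fin B) :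
    P.map (fun ω => (S.run μ γ θ₀ t d (N.noise ω), N.pert t ω, N.samp t ω l j))
      = (P.map fun ω => S.run μ γ θ₀ t d (N.noise ω)).prod
          ((stdGaussian (Param n)).prod (S.law l)) := by
  have hs : Measurable fun ω => N.samp t ω l j := by
    have := hN.samp_meas t
    fun_prop
  have h1 : IndepFun (fun ω => S.run μ γ θ₀ t d (N.noise ω))
      (fun ω => (N.pert t ω, N.samp t ω l j)) P :=
    (h.indepFun_run μ γ θ₀ hN d t).comp (φ := id)
      (ψ := fun q : Param n × (Fin m → Fin B → Sample s) => (q.1, q.2 l j))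
      measurable_id (by fun_prop)
  have h2 : IndepFun (N.pert t) (fun ω => N.samp t ω l j) P :=
    (hN.pert_samp t).comp (φ := id) (ψ := fun q : Fin m → Fin B → Sample s => q l j)
      measurable_id (by fun_prop)
  rw [indepFun_iff_map_prod_eq_prod_map_map (h.measurable_run_noise μ γ θ₀ hN d t).aemeasurable
    ((hN.pert_meas t).prodMk hs).aemeasurable] at h1
  rw [indepFun_iff_map_prod_eq_prod_map_map (hN.pert_meas t).aemeasurable hs.aemeasurable,
    hN.pert_law, hN.samp_law] at h2
  rw [h1, h2]

end AsyncZO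

namespace AsyncZO

variable {m s B : ℕ} {n : Fin m → ℕ}

/-! ### Moments of the reports -/

section Moments

variable {S : System m n s} {L₀ L σ G : ℝ} {D : ℕ}
  {Ω : Type u} [MeasurableSpace Ω] {P : Measure Ω} [IsProbabilityMeasure P]
  {N : Inputs m n s B Ω} (μ : ℝ) (γ : Fin m → ℕ → ℝ) (θ₀ : Param n) (d : Delays m)

/-- The random iterate for fixed delays. -/
noncomputable abbrev iter (S : System m n s) (N : Inputs m n s B Ω) (μ : ℝ) (γ : Fin m → ℕ → ℝ)
    (θ₀ : Param n) (d : Delays m) (t : ℕ) (ω : Ω) : Param n :=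
  S.run μ γ θ₀ t d (N.noise ω)

/-- A bound on the second moment of each coordinate of a report. -/
noncomputable def reportBound (n : Fin m → ℕ) (σ G : ℝ) : ℝ :=
  (2 * σ ^ 2 + 2 * G ^ 2) * gaussMoment n 4

theorem reportBound_nonneg (n : Fin m → ℕ) (σ G : ℝ) : 0 ≤ reportBound n σ G :=
  mul_nonneg (by positivity) (gaussMoment_nonneg n 4)

omit [MeasurableSpace Ω] in
theorem System.report_eq (l : Fin m) (p : Σ i : Fin m, Fin (n i)) (τ : ℕ) (ω : Ω) :
    S.report μ γ θ₀ l p τ d (N.noise ω) = (1 / (μ * m * B)) * ∑ j,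
      S.twoPoint μ l p (iter S N μ γ θ₀ d τ ω, N.pert τ ω, N.samp τ ω l j) := by
  unfold System.report query System.twoPoint
  rw [mul_assoc, Finset.sum_mul]
  rfl

variable (h : S.Regular L₀ L σ G D) (hN : N.Admissible S D P)

include h hN

theorem System.Regular.lintegral_twoPoint_iter (l : Fin m) (p : Σ i : Fin m, Fin (n i)) (τ : ℕ)
    (j : Fin B) :
    ∫⁻ ω, ENNReal.ofReal (S.twoPoint μ l p
      (iter S N μ γ θ₀ d τ ω, N.pert τ ω, N.samp τ ω l j) ^ 2) ∂P
      ≤ ENNReal.ofReal ((2 * σ ^ 2 + 2 * G ^ 2) * μ ^ 2 * gaussMoment n 4) := by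
  have := h.law_prob l
  have hmeas : Measurable fun z => ENNReal.ofReal (S.twoPoint μ l p z ^ 2) :=
    ENNReal.measurable_ofReal.comp ((h.measurable_twoPoint μ l p).pow_const 2)
  have hx := h.measurable_run_noise μ γ θ₀ hN d τ
  have hs : Measurable fun ω => N.samp τ ω l j := by
    have := hN.samp_meas τ
    fun_prop
  have := Measure.isProbabilityMeasure_map (μ := P) hx.aemeasurable
  rw [← lintegral_map hmeas (hx.prodMk ((hN.pert_meas τ).prodMk hs)),
    h.map_run_pert_samp μ γ θ₀ hN d τ l j, lintegral_prod _ hmeas.aemeasurable]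
  refine (lintegral_mono fun x => h.lintegral_twoPoint_sq_le μ l p x).trans ?_
  rw [lintegral_const, measure_univ, mul_one]

omit [IsProbabilityMeasure P] in
theorem System.Regular.measurable_twoPoint_iter (l : Fin m) (p : Σ i : Fin m, Fin (n i))
    (τ : ℕ) (j : Fin B) : Measurable fun ω =>
      S.twoPoint μ l p (iter S N μ γ θ₀ d τ ω, N.pert τ ω, N.samp τ ω l j) := by
  have hs : Measurable fun ω => N.samp τ ω l j := by
    have := hN.samp_meas τ
    fun_prop
  exact (h.measurable_twoPoint μ l p).comp
    ((h.measurable_run_noise μ γ θ₀ hN d τ).prodMk ((hN.pert_meas τ).prodMk hs))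

theorem System.Regular.memLp_twoPoint_iter (l : Fin m) (p : Σ i : Fin m, Fin (n i)) (τ : ℕ)
    (j : Fin B) : MemLp (fun ω => S.twoPoint μ l p
      (iter S N μ γ θ₀ d τ ω, N.pert τ ω, N.samp τ ω l j)) 2 P :=
  memLp_two_of_lintegral_sq_le
    (h.measurable_twoPoint_iter μ γ θ₀ d hN l p τ j).aestronglyMeasurable
    (h.lintegral_twoPoint_iter μ γ θ₀ d hN l p τ j)

theorem System.Regular.memLp_report (l : Fin m) (p : Σ i : Fin m, Fin (n i)) (τ : ℕ) :
    MemLp (fun ω => S.report μ γ θ₀ l p τ d (N.noise ω)) 2 P := by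
  simp_rw [System.report_eq]
  exact (memLp_finsetSum _ fun j _ =>
    h.memLp_twoPoint_iter μ γ θ₀ d hN l p τ j).const_mul _

/-- Cauchy–Schwarz over the minibatch gives `B²`, cancelled by the averaging, and the `μ²` of the
two-point difference cancels `1/μ²`. The remaining `1/m²` is bounded by `1`, so the bound is free of
`μ`. -/
theorem System.Regular.integral_report_sq_le (hμ : 0 < μ) (hB : 0 < B) (l : Fin m)
    (p : Σ i : Fin m, Fin (n i)) (τ : ℕ) :
    ∫ ω, S.report μ γ θ₀ l p τ d (N.noise ω) ^ 2 ∂P ≤ reportBound n σ G := by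
  have hm : (1 : ℝ) ≤ m := by exact_mod_cast (l.pos : 0 < m)
  have hB' : (0 : ℝ) < B := by exact_mod_cast hB
  have hM := gaussMoment_nonneg n 4
  set X : Fin B → Ω → ℝ := fun j ω =>
    S.twoPoint μ l p (iter S N μ γ θ₀ d τ ω, N.pert τ ω, N.samp τ ω l j) with hX
  have hmem : ∀ j, MemLp (X j) 2 P := fun j => h.memLp_twoPoint_iter μ γ θ₀ d hN l p τ j
  have hsq : ∀ j, ∫ ω, X j ω ^ 2 ∂P ≤ (2 * σ ^ 2 + 2 * G ^ 2) * μ ^ 2 * gaussMoment n 4 :=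
    fun j => integral_sq_le_of_lintegral_sq_le (hmem j).aestronglyMeasurable (by positivity)
      (h.lintegral_twoPoint_iter μ γ θ₀ d hN l p τ j)
  calc _ ≤ ∫ ω, (1 / (μ * m * B)) ^ 2 * (B * ∑ j, X j ω ^ 2) ∂P := by
        refine integral_mono (h.memLp_report μ γ θ₀ d hN l p τ).integrable_sq
          (((integrable_finsetSum _ fun j _ => (hmem j).integrable_sq).const_mul _).const_mul _)
          fun ω => ?_
        simp only
        rw [System.report_eq, mul_pow]
        have := sq_sum_le_card_mul_sum_sq (s := Finset.univ) (f := fun j => X j ω)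
        rw [Finset.card_univ, Fintype.card_fin] at this
        gcongr
    _ = (1 / (μ * m * B)) ^ 2 * (B * ∑ j, ∫ ω, X j ω ^ 2 ∂P) := by
        rw [integral_const_mul, integral_const_mul,
          integral_finsetSum _ fun j _ => (hmem j).integrable_sq]
    _ ≤ (1 / (μ * m * B)) ^ 2 * (B * ∑ j : Fin B,
          (2 * σ ^ 2 + 2 * G ^ 2) * μ ^ 2 * gaussMoment n 4) := by
        gcongr with j
        exact hsq j
    _ = (1 / (m : ℝ) ^ 2) * reportBound n σ G := by
        rw [Finset.sum_const, Finset.card_univ, Fintype.card_fin, nsmul_eq_mul, reportBound]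
        field_simp
    _ ≤ 1 * reportBound n σ G := by
        gcongr
        · exact reportBound_nonneg n σ G
        · rw [div_le_one (by positivity)]
          nlinarith
    _ = _ := one_mul _

/-- In expectation, a report is a descent direction up to a bias of order `μ`. -/
theorem System.Regular.abs_integral_mul_report_add_le (hL : 0 ≤ L) (hμ : 0 < μ) (hB : 0 < B)
    (l : Fin m) (p : Σ i : Fin m, Fin (n i)) (τ : ℕ) {φ : Param n → ℝ} (hφ : Measurable φ) {C : ℝ}
    (hC : ∀ x, |φ x| ≤ C) :
    |∫ ω, φ (iter S N μ γ θ₀ d τ ω) * S.report μ γ θ₀ l p τ d (N.noise ω) ∂P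
      + (1 / m) * ∫ ω, φ (iter S N μ γ θ₀ d τ ω)
          * gradient (S.f l) (iter S N μ γ θ₀ d τ ω) p ∂P|
      ≤ (1 / m) * (L * μ * gaussMoment n 3 * ∫ ω, |φ (iter S N μ γ θ₀ d τ ω)| ∂P) := by
  have := h.law_prob l
  have hm : (0 : ℝ) < m := by exact_mod_cast (l.pos : 0 < m)
  have hB' : (0 : ℝ) < B := by exact_mod_cast hB
  have hM := gaussMoment_nonneg n 3
  have hx : Measurable (iter S N μ γ θ₀ d τ) := h.measurable_run_noise μ γ θ₀ hN d τ
  have hgc : Continuous fun x : Param n => gradient (S.f l) x p :=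
    (by fun_prop : Continuous fun x : Param n => x p).comp (continuous_gradient (h.f_smooth l))
  have hφg : Integrable (fun x => φ x * gradient (S.f l) x p) (P.map (iter S N μ γ θ₀ d τ)) := by
    have := Measure.isProbabilityMeasure_map (μ := P) hx.aemeasurable
    refine Integrable.of_bound (C := C * G)
      (hφ.mul hgc.measurable).aestronglyMeasurable (Eventually.of_forall fun x => ?_)
    rw [norm_mul, Real.norm_eq_abs, Real.norm_eq_abs]
    have h1 := (abs_apply_le_norm _ p).trans (h.f_grad l x)
    exact mul_le_mul (hC x) h1 (abs_nonneg _) ((abs_nonneg _).trans (hC x))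
  have hφa : Integrable (fun x => |φ x|) (P.map (iter S N μ γ θ₀ d τ)) := by
    have := Measure.isProbabilityMeasure_map (μ := P) hx.aemeasurable
    refine Integrable.of_bound (C := C) (hφ.norm).aestronglyMeasurable
      (Eventually.of_forall fun x => ?_)
    simpa using hC x
  have hmemφ : MemLp (fun ω => φ (iter S N μ γ θ₀ d τ ω)) 2 P :=
    MemLp.of_bound (hφ.comp hx).aestronglyMeasurable C (Eventually.of_forall fun ω => hC _)
  set X : Fin B → Ω → ℝ := fun j ω =>
    S.twoPoint μ l p (iter S N μ γ θ₀ d τ ω, N.pert τ ω, N.samp τ ω l j) with hX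
  have hmem : ∀ j, MemLp (X j) 2 P := fun j => h.memLp_twoPoint_iter μ γ θ₀ d hN l p τ j
  have hint : ∀ j, Integrable (fun ω => φ (iter S N μ γ θ₀ d τ ω) * X j ω) P :=
    fun j => hmemφ.integrable_mul (hmem j)
  set I := ∫ ω, φ (iter S N μ γ θ₀ d τ ω)
    * gradient (S.f l) (iter S N μ γ θ₀ d τ ω) p ∂P with hI
  set A := ∫ ω, |φ (iter S N μ γ θ₀ d τ ω)| ∂P with hA
  -- For each sample the weight depends on the iterate alone, so Fubini leaves the mean of the
  -- two-point difference at a frozen `x`, where the pointwise bias bound applies.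
  have key : ∀ j, |∫ ω, φ (iter S N μ γ θ₀ d τ ω) * X j ω ∂P + μ * I|
      ≤ L * μ ^ 2 * gaussMoment n 3 * A := by
    intro j
    have hs : Measurable fun ω => N.samp τ ω l j := by
      have := hN.samp_meas τ
      fun_prop
    have hz : Measurable fun ω => (iter S N μ γ θ₀ d τ ω, N.pert τ ω, N.samp τ ω l j) :=
      hx.prodMk ((hN.pert_meas τ).prodMk hs)
    have hmeas : Measurable fun z : Param n × Param n × Sample s => φ z.1 * S.twoPoint μ l p z :=
      (hφ.comp measurable_fst).mul (h.measurable_twoPoint μ l p)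
    have hint' : Integrable (fun z : Param n × Param n × Sample s => φ z.1 * S.twoPoint μ l p z)
        ((P.map (iter S N μ γ θ₀ d τ)).prod ((stdGaussian (Param n)).prod (S.law l))) := by
      rw [← h.map_run_pert_samp μ γ θ₀ hN d τ l j]
      exact (integrable_map_measure hmeas.aestronglyMeasurable hz.aemeasurable).2 (hint j)
    have h1 : ∫ ω, φ (iter S N μ γ θ₀ d τ ω) * X j ω ∂P
        = ∫ x, φ x * ∫ z, S.twoPoint μ l p (x, z) ∂((stdGaussian (Param n)).prod (S.law l))
            ∂(P.map (iter S N μ γ θ₀ d τ)) := by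
      rw [← integral_map (f := fun z : Param n × Param n × Sample s =>
          φ z.1 * S.twoPoint μ l p z) hz.aemeasurable hmeas.aestronglyMeasurable,
          h.map_run_pert_samp μ γ θ₀ hN d τ l j, integral_prod _ hint']
      refine integral_congr_ae (Eventually.of_forall fun x => ?_)
      simp only [integral_const_mul]
    have h1' : Integrable (fun x => φ x * ∫ z, S.twoPoint μ l p (x, z)
          ∂((stdGaussian (Param n)).prod (S.law l))) (P.map (iter S N μ γ θ₀ d τ)) := by
      have := hint'.integral_prod_left
      simpa only [integral_const_mul] using this
    have h2 : I = ∫ x, φ x * gradient (S.f l) x p ∂(P.map (iter S N μ γ θ₀ d τ)) :=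
      (integral_map hx.aemeasurable hφg.aestronglyMeasurable).symm
    have h3 : A = ∫ x, |φ x| ∂(P.map (iter S N μ γ θ₀ d τ)) :=
      (integral_map hx.aemeasurable hφa.aestronglyMeasurable).symm
    rw [h1, h2, h3, ← integral_const_mul, ← integral_const_mul,
      ← integral_add h1' (hφg.const_mul μ), ← Real.norm_eq_abs]
    refine (norm_integral_le_integral_norm _).trans ?_
    refine integral_mono (h1'.add (hφg.const_mul μ)).norm (hφa.const_mul _) fun x => ?_
    have h4 := h.abs_integral_twoPoint_add_le hL μ l p x
    have h5 : φ x * ∫ z, S.twoPoint μ l p (x, z) ∂((stdGaussian (Param n)).prod (S.law l))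
        + μ * (φ x * gradient (S.f l) x p)
        = φ x * (∫ z, S.twoPoint μ l p (x, z) ∂((stdGaussian (Param n)).prod (S.law l))
          + μ * gradient (S.f l) x p) := by ring
    simp only
    rw [h5, norm_mul, Real.norm_eq_abs, Real.norm_eq_abs, mul_comm]
    gcongr
  have hsum : ∫ ω, φ (iter S N μ γ θ₀ d τ ω) * S.report μ γ θ₀ l p τ d (N.noise ω) ∂P
      + (1 / m) * I = (1 / (μ * m * B)) *
        ∑ j, (∫ ω, φ (iter S N μ γ θ₀ d τ ω) * X j ω ∂P + μ * I) := by
    have h1 : ∀ ω, φ (iter S N μ γ θ₀ d τ ω) * S.report μ γ θ₀ l p τ d (N.noise ω)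
        = (1 / (μ * m * B)) * ∑ j, φ (iter S N μ γ θ₀ d τ ω) * X j ω := by
      intro ω
      rw [System.report_eq, ← Finset.mul_sum]
      ring
    simp_rw [h1]
    rw [integral_const_mul, integral_finsetSum _ fun j _ => hint j, Finset.sum_add_distrib,
      Finset.sum_const, Finset.card_univ, Fintype.card_fin, nsmul_eq_mul, mul_add]
    congr 1
    field_simp
  rw [hsum, abs_mul, abs_of_nonneg (by positivity : (0 : ℝ) ≤ 1 / (μ * m * B))]
  calc _ ≤ 1 / (μ * m * B) * ∑ j : Fin B, L * μ ^ 2 * gaussMoment n 3 * A := by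
        gcongr
        exact (Finset.abs_sum_le_sum_abs _ _).trans (Finset.sum_le_sum fun j _ => key j)
    _ = _ := by
        rw [Finset.sum_const, Finset.card_univ, Fintype.card_fin, nsmul_eq_mul]
        field_simp

/-! ### Increments of the iterates -/

theorem System.Regular.memLp_direction (p : Σ i : Fin m, Fin (n i)) (t : ℕ) :
    MemLp (fun ω => S.direction μ γ θ₀ p t d (N.noise ω)) 2 P := by
  unfold System.direction
  split_ifs
  · refine memLp_finsetSum _ fun l _ => ?_
    split_ifs
    · exact h.memLp_report μ γ θ₀ d hN l p _
    · exact MemLp.zero'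
  · exact MemLp.zero'

/-- Cauchy–Schwarz over at most `m` neighbours yields the factor `m²`; empty memories and idle
agents contribute zero. -/
theorem System.Regular.integral_direction_sq_le (hμ : 0 < μ) (hB : 0 < B)
    (p : Σ i : Fin m, Fin (n i)) (t : ℕ) :
    ∫ ω, S.direction μ γ θ₀ p t d (N.noise ω) ^ 2 ∂P ≤ m ^ 2 * reportBound n σ G := by
  have hR := reportBound_nonneg n σ G
  unfold System.direction
  split_ifs
  · set X : Fin m → Ω → ℝ := fun l ω => if (memory (S.Tq l) (d p.1 l) t).isSome then
      S.report μ γ θ₀ l p (stamp (S.Tq l) (d p.1 l) t) d (N.noise ω) else 0 with hX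
    have hmem : ∀ l, MemLp (X l) 2 P := by
      intro l
      simp only [hX]
      split_ifs
      · exact h.memLp_report μ γ θ₀ d hN l p _
      · exact MemLp.zero'
    have hsq : ∀ l, ∫ ω, X l ω ^ 2 ∂P ≤ reportBound n σ G := by
      intro l
      simp only [hX]
      split_ifs
      · exact h.integral_report_sq_le μ γ θ₀ d hN hμ hB l p _
      · simpa using hR
    have hcard : ((S.nrx p.1).card : ℝ) ≤ m := by
      exact_mod_cast (Finset.card_le_univ _).trans (by simp)
    calc _ ≤ ∫ ω, (m : ℝ) * ∑ l ∈ S.nrx p.1, X l ω ^ 2 ∂P := by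
          refine integral_mono (memLp_finsetSum _ fun l _ => hmem l).integrable_sq
            ((integrable_finsetSum _ fun l _ => (hmem l).integrable_sq).const_mul _) fun ω => ?_
          refine (sq_sum_le_card_mul_sum_sq (s := S.nrx p.1) (f := fun l => X l ω)).trans ?_
          gcongr
      _ = m * ∑ l ∈ S.nrx p.1, ∫ ω, X l ω ^ 2 ∂P := by
          rw [integral_const_mul, integral_finsetSum _ fun l _ => (hmem l).integrable_sq]
      _ ≤ m * ∑ l ∈ S.nrx p.1, reportBound n σ G := by
          gcongr with l
          exact hsq l
      _ ≤ m * (m * reportBound n σ G) := by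
          rw [Finset.sum_const, nsmul_eq_mul]
          gcongr
      _ = _ := by ring
  · simp only [ne_eq, OfNat.ofNat_ne_zero, not_false_eq_true, zero_pow, integral_zero]
    positivity

theorem System.Regular.memLp_iter (t : ℕ) : MemLp (iter S N μ γ θ₀ d t) 2 P := by
  induction t with
  | zero =>
    have : iter S N μ γ θ₀ d 0 = fun _ => θ₀ := funext fun ω => S.run_zero μ γ θ₀ d _
    rw [this]
    exact memLp_const _
  | succ t ih =>
    refine MemLp.of_eval_piLp fun p => ?_
    simp only [System.run_succ_apply]
    exact (MemLp.eval_piLp ih p).add ((h.memLp_direction μ γ θ₀ d hN p t).const_mul _)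

/-- A bound on the second moment of an update direction. -/
noncomputable def stepBound (n : Fin m → ℕ) (σ G : ℝ) : ℝ :=
  Fintype.card (Σ i : Fin m, Fin (n i)) * (m ^ 2 * reportBound n σ G)

omit h hN in
theorem stepBound_nonneg (n : Fin m → ℕ) (σ G : ℝ) : 0 ≤ stepBound n σ G :=
  mul_nonneg (by positivity) (mul_nonneg (by positivity) (reportBound_nonneg n σ G))

theorem System.Regular.integral_norm_iter_succ_sub_sq_le (hμ : 0 < μ) (hB : 0 < B) (t : ℕ)
    {g : ℝ} (hg : ∀ i, |γ i t| ≤ g) :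
    ∫ ω, ‖iter S N μ γ θ₀ d (t + 1) ω - iter S N μ γ θ₀ d t ω‖ ^ 2 ∂P
      ≤ g ^ 2 * stepBound n σ G := by
  have h1 : ∀ ω, ‖iter S N μ γ θ₀ d (t + 1) ω - iter S N μ γ θ₀ d t ω‖ ^ 2
      = ∑ p : (Σ i : Fin m, Fin (n i)),
        γ p.1 t ^ 2 * S.direction μ γ θ₀ p t d (N.noise ω) ^ 2 := by
    intro ω
    rw [EuclideanSpace.real_norm_sq_eq]
    refine Finset.sum_congr rfl fun p _ => ?_
    rw [PiLp.sub_apply, System.run_succ_apply, add_sub_cancel_left, mul_pow]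
  simp_rw [h1]
  rw [integral_finsetSum _ fun p _ =>
    ((h.memLp_direction μ γ θ₀ d hN p t).integrable_sq).const_mul _]
  calc _ ≤ ∑ p : (Σ i : Fin m, Fin (n i)), g ^ 2 * (m ^ 2 * reportBound n σ G) := by
        refine Finset.sum_le_sum fun p _ => ?_
        rw [integral_const_mul]
        refine mul_le_mul ?_ (h.integral_direction_sq_le μ γ θ₀ d hN hμ hB p t)
          (integral_nonneg fun _ => sq_nonneg _) (sq_nonneg _)
        rw [← sq_abs]
        exact pow_le_pow_left₀ (abs_nonneg _) (hg p.1) 2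
    _ = _ := by
        rw [Finset.sum_const, Finset.card_univ, nsmul_eq_mul, stepBound]
        ring

theorem System.Regular.integrable_norm_iter_sub_sq (t τ : ℕ) :
    Integrable (fun ω => ‖iter S N μ γ θ₀ d t ω - iter S N μ γ θ₀ d τ ω‖ ^ 2) P :=
  ((h.memLp_iter μ γ θ₀ d hN t).sub (h.memLp_iter μ γ θ₀ d hN τ)).integrable_norm_pow
    (p := 2) (by simp)

/-- Telescoping and Cauchy–Schwarz over at most `K` increments. One factor `K` comes from the
inequality, the other from the number of terms. -/
theorem System.Regular.integral_norm_iter_sub_sq_le (hμ : 0 < μ) (hB : 0 < B) {t τ K : ℕ}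
    (hτ : τ ≤ t) (ht : t ≤ τ + K) {g : ℝ} (hg : ∀ i k, τ ≤ k → k < t → |γ i k| ≤ g) :
    ∫ ω, ‖iter S N μ γ θ₀ d t ω - iter S N μ γ θ₀ d τ ω‖ ^ 2 ∂P
      ≤ K ^ 2 * (g ^ 2 * stepBound n σ G) := by
  have hS := stepBound_nonneg n σ G
  have hcard : ((Finset.Ico τ t).card : ℝ) ≤ K := by
    rw [Nat.card_Ico]
    exact_mod_cast (by omega : t - τ ≤ K)
  have hint := fun k => h.integrable_norm_iter_sub_sq (P := P) μ γ θ₀ d hN (k + 1) k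
  calc _ ≤ ∫ ω, (K : ℝ) * ∑ k ∈ Finset.Ico τ t,
        ‖iter S N μ γ θ₀ d (k + 1) ω - iter S N μ γ θ₀ d k ω‖ ^ 2 ∂P := by
        refine integral_mono (h.integrable_norm_iter_sub_sq μ γ θ₀ d hN t τ)
          ((integrable_finsetSum _ fun k _ => hint k).const_mul _) fun ω => ?_
        have h1 := Finset.sum_Ico_sub (fun k => iter S N μ γ θ₀ d k ω) hτ
        simp only
        rw [← h1]
        refine (pow_le_pow_left₀ (norm_nonneg _) (norm_sum_le _ _) 2).trans ?_
        refine sq_sum_le_card_mul_sum_sq.trans ?_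
        gcongr
    _ = K * ∑ k ∈ Finset.Ico τ t,
        ∫ ω, ‖iter S N μ γ θ₀ d (k + 1) ω - iter S N μ γ θ₀ d k ω‖ ^ 2 ∂P := by
        rw [integral_const_mul, integral_finsetSum _ fun k _ => hint k]
    _ ≤ K * ∑ k ∈ Finset.Ico τ t, g ^ 2 * stepBound n σ G := by
        gcongr with k hk
        rw [Finset.mem_Ico] at hk
        exact h.integral_norm_iter_succ_sub_sq_le μ γ θ₀ d hN hμ hB k fun i => hg i k hk.1 hk.2
    _ ≤ K * (K * (g ^ 2 * stepBound n σ G)) := by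
        rw [Finset.sum_const, nsmul_eq_mul]
        gcongr
    _ = _ := by ring

end Moments

end AsyncZO

namespace AsyncZO

variable {m s B : ℕ} {n : Fin m → ℕ}

/-! ### Descent of the global cost -/

/-- The stepsizes `γ` are comparable to a slowly decreasing sequence `a`. -/
structure SlowStep (γ : Fin m → ℕ → ℝ) (a : ℕ → ℝ) (c₀ c₁ ρ : ℝ) (D : ℕ) : Prop where
  pos : ∀ t, 0 < a t
  anti : Antitone a
  slow : ∀ t k, t ≤ k + 3 * D → a k ≤ ρ * a t
  c₀_pos : 0 < c₀
  c₁_pos : 0 < c₁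
  lower : ∀ i t, c₀ * a t ≤ γ i t
  upper : ∀ i t, γ i t ≤ c₁ * a t

/-- The squared lag of outdated iterates is at most this constant times the squared stepsize. -/
noncomputable def lagBound (n : Fin m → ℕ) (σ G : ℝ) (D : ℕ) (c₁ ρ : ℝ) : ℝ :=
  ((3 * D : ℕ) : ℝ) ^ 2 * ((c₁ * ρ) ^ 2 * stepBound n σ G)

theorem lagBound_nonneg (n : Fin m → ℕ) (σ G : ℝ) (D : ℕ) (c₁ ρ : ℝ) :
    0 ≤ lagBound n σ G D c₁ ρ :=
  mul_nonneg (sq_nonneg _) (mul_nonneg (sq_nonneg _) (stepBound_nonneg n σ G))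

/-- The factor of the stepsize in the error of the update directions. -/
noncomputable def alignBound (n : Fin m → ℕ) (L σ G : ℝ) (D : ℕ) (c₁ ρ a₀ : ℝ) : ℝ :=
  2 * G * L * (lagBound n σ G D c₁ ρ + 1)
    + m * (L * (lagBound n σ G D c₁ ρ + reportBound n σ G))
    + (G ^ 2 + m ^ 2 * reportBound n σ G) * (ρ / a₀)

/-- The factor of the squared stepsize in the descent inequality. -/
noncomputable def descentBound (n : Fin m → ℕ) (L σ G : ℝ) (D : ℕ) (c₁ ρ a₀ : ℝ) : ℝ :=
  Fintype.card (Σ i : Fin m, Fin (n i)) * (c₁ * alignBound n L σ G D c₁ ρ a₀)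
    + L * (c₁ ^ 2 * stepBound n σ G)

/-- The factor of `μ²` times the stepsize in the descent inequality. -/
noncomputable def biasBound (n : Fin m → ℕ) (L c₁ : ℝ) : ℝ :=
  Fintype.card (Σ i : Fin m, Fin (n i)) * (c₁ * (L * gaussMoment n 3) ^ 2)

variable {S : System m n s} {L₀ L σ G : ℝ} {D : ℕ}
  {Ω : Type u} [MeasurableSpace Ω] {P : Measure Ω} [IsProbabilityMeasure P]
  {N : Inputs m n s B Ω} {μ : ℝ} {γ : Fin m → ℕ → ℝ} (θ₀ : Param n) (d : Delays m)
  {a : ℕ → ℝ} {c₀ c₁ ρ : ℝ}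

theorem SlowStep.abs_le (hγ : SlowStep γ a c₀ c₁ ρ D) (i : Fin m) (t : ℕ) :
    |γ i t| ≤ c₁ * a t := by
  rw [abs_of_nonneg ((mul_pos hγ.c₀_pos (hγ.pos t)).le.trans (hγ.lower i t))]
  exact hγ.upper i t

theorem SlowStep.ρ_pos (hγ : SlowStep γ a c₀ c₁ ρ D) : 0 < ρ := by
  have h1 := hγ.slow 0 0 (Nat.zero_le _)
  have h2 := hγ.pos 0
  by_contra hc
  nlinarith

theorem alignBound_nonneg (hγ : SlowStep γ a c₀ c₁ ρ D) (hL : 0 ≤ L) (hG : 0 ≤ G) :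
    0 ≤ alignBound n L σ G D c₁ ρ (a 0) := by
  have := lagBound_nonneg n σ G D c₁ ρ
  have := reportBound_nonneg n σ G
  have := hγ.ρ_pos
  have := hγ.pos 0
  unfold alignBound
  positivity

theorem descentBound_nonneg (hγ : SlowStep γ a c₀ c₁ ρ D) (hL : 0 ≤ L) (hG : 0 ≤ G) :
    0 ≤ descentBound n L σ G D c₁ ρ (a 0) := by
  have := alignBound_nonneg (n := n) (σ := σ) hγ hL hG
  have := stepBound_nonneg n σ G
  have := hγ.c₁_pos
  unfold descentBound
  positivity

theorem biasBound_nonneg (hγ : SlowStep γ a c₀ c₁ ρ D) (L : ℝ) :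
    0 ≤ biasBound n L c₁ := by
  have := hγ.c₁_pos
  unfold biasBound
  positivity

variable (hN : N.Admissible S D P)

theorem System.Regular.abs_gradient_cost_apply_le (h : S.Regular L₀ L σ G D) (hG : 0 ≤ G)
    (x : Param n) (p : Σ i : Fin m, Fin (n i)) : |gradient S.cost x p| ≤ G :=
  (abs_apply_le_norm _ p).trans (h.cost_grad hG x)

theorem System.Regular.abs_gradient_cost_apply_sub_le (h : S.Regular L₀ L σ G D) (hL : 0 ≤ L)
    (x y : Param n) (p : Σ i : Fin m, Fin (n i)) :
    |gradient S.cost x p - gradient S.cost y p| ≤ L * ‖x - y‖ := by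
  rw [← PiLp.sub_apply]
  exact (abs_apply_le_norm _ p).trans (h.cost_smooth hL x y)

theorem System.Regular.measurable_gradient_cost_apply (h : S.Regular L₀ L σ G D) (hL : 0 ≤ L)
    (p : Σ i : Fin m, Fin (n i)) : Measurable fun x => gradient S.cost x p :=
  ((by fun_prop : Continuous fun x : Param n => x p).comp
    (continuous_gradient (h.cost_smooth hL))).measurable

theorem System.Regular.measurable_gradient_apply (h : S.Regular L₀ L σ G D) (l : Fin m)
    (p : Σ i : Fin m, Fin (n i)) : Measurable fun x => gradient (S.f l) x p :=
  ((by fun_prop : Continuous fun x : Param n => x p).comp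
    (continuous_gradient (h.f_smooth l))).measurable

/-- A product of two bounded Lipschitz functions is Lipschitz. -/
theorem abs_mul_sub_mul_le {a b c e G δ : ℝ} (ha : |a| ≤ G) (he : |e| ≤ G) (h1 : |a - c| ≤ δ)
    (h2 : |b - e| ≤ δ) : |a * b - c * e| ≤ 2 * G * δ := by
  have : a * b - c * e = a * (b - e) + e * (a - c) := by ring
  rw [this]
  refine (abs_add_le _ _).trans ?_
  rw [abs_mul, abs_mul]
  have hG : 0 ≤ G := (abs_nonneg _).trans ha
  have := mul_le_mul ha h2 (abs_nonneg _) hG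
  have := mul_le_mul he h1 (abs_nonneg _) hG
  linarith

theorem integrable_comp_of_abs_le {X : Ω → Param n} (hX : Measurable X) {φ : Param n → ℝ}
    (hφ : Measurable φ) {C : ℝ} (hC : ∀ x, |φ x| ≤ C) : Integrable (fun ω => φ (X ω)) P :=
  Integrable.of_bound (C := C) (hφ.comp hX).aestronglyMeasurable
    (Eventually.of_forall fun _ => hC _)

/-- A second moment bound gives a first moment bound. -/
theorem integral_norm_le_of_integral_sq_le {E : Type*} [NormedAddCommGroup E] {X : Ω → E}
    (hX : MemLp X 2 P) {Q b : ℝ} (hb : 0 < b) (h : ∫ ω, ‖X ω‖ ^ 2 ∂P ≤ Q * b ^ 2) :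
    ∫ ω, ‖X ω‖ ∂P ≤ (Q + 1) / 2 * b := by
  have hsq : Integrable (fun ω => ‖X ω‖ ^ 2) P := hX.integrable_norm_pow (p := 2) (by simp)
  -- The arithmetic-geometric mean inequality with weight `b` makes both terms linear in `b`.
  calc _ ≤ ∫ ω, (1 / (2 * b) * ‖X ω‖ ^ 2 + b / 2) ∂P := by
        refine integral_mono (hX.integrable (by simp)).norm
          ((hsq.const_mul _).add (integrable_const _)) fun ω => ?_
        have h1 : 1 / (2 * b) * ‖X ω‖ ^ 2 + b / 2 - ‖X ω‖
            = 1 / (2 * b) * (‖X ω‖ - b) ^ 2 := by field_simp; ring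
        have h2 : 0 ≤ 1 / (2 * b) * (‖X ω‖ - b) ^ 2 := by positivity
        simp only
        linarith
    _ = 1 / (2 * b) * ∫ ω, ‖X ω‖ ^ 2 ∂P + b / 2 := by
        rw [integral_add (hsq.const_mul _) (integrable_const _), integral_const_mul]
        simp
    _ ≤ 1 / (2 * b) * (Q * b ^ 2) + b / 2 := by gcongr
    _ = _ := by field_simp

include hN

/-- The reference stepsize `b` is left free because the bound serves windows ending at the reference
time (outdated reports) as well as windows beginning there (blocks of updates). -/
theorem System.Regular.integral_lag_sq_le (h : S.Regular L₀ L σ G D)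
    (hγ : SlowStep γ a c₀ c₁ ρ D) (hμ : 0 < μ) (hB : 0 < B) {t τ : ℕ} (hτ : τ ≤ t)
    (ht : t ≤ τ + 3 * D) {b : ℝ} (hb : ∀ k, τ ≤ k → a k ≤ ρ * b) :
    ∫ ω, ‖iter S N μ γ θ₀ d t ω - iter S N μ γ θ₀ d τ ω‖ ^ 2 ∂P
      ≤ lagBound n σ G D c₁ ρ * b ^ 2 := by
  have hc := hγ.c₁_pos
  refine (h.integral_norm_iter_sub_sq_le μ γ θ₀ d hN hμ hB hτ ht (g := c₁ * (ρ * b))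
    fun i k hk _ => (hγ.abs_le i k).trans ?_).trans_eq ?_
  · exact mul_le_mul_of_nonneg_left (hb k hk) hc.le
  · rw [lagBound]; ring

/-- The correlation of the current gradient with an outdated report. -/
theorem System.Regular.integral_gradient_mul_report_le (h : S.Regular L₀ L σ G D) (hL : 0 ≤ L)
    (hG : 0 ≤ G) (hμ : 0 < μ) (hB : 0 < B) (l : Fin m) (p : Σ i : Fin m, Fin (n i)) {t τ : ℕ}
    {Q b : ℝ} (hb : 0 < b)
    (hQ : ∫ ω, ‖iter S N μ γ θ₀ d t ω - iter S N μ γ θ₀ d τ ω‖ ^ 2 ∂P ≤ Q * b ^ 2) :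
    ∫ ω, gradient S.cost (iter S N μ γ θ₀ d t ω) p * S.report μ γ θ₀ l p τ d (N.noise ω) ∂P
      ≤ (1 / m) * (-∫ ω, gradient S.cost (iter S N μ γ θ₀ d t ω) p
            * gradient (S.f l) (iter S N μ γ θ₀ d t ω) p ∂P
          + 1 / 4 * ∫ ω, gradient S.cost (iter S N μ γ θ₀ d t ω) p ^ 2 ∂P
          + (L * gaussMoment n 3) ^ 2 * μ ^ 2 + 2 * G * L * (Q + 1) * b)
        + L * (Q + reportBound n σ G) * b := by
  have hm : (0 : ℝ) < m := by exact_mod_cast (l.pos : 0 < m)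
  have hM := gaussMoment_nonneg n 3
  set Y := iter S N μ γ θ₀ d t with hY
  set Z := iter S N μ γ θ₀ d τ with hZ
  set R : Ω → ℝ := fun ω => S.report μ γ θ₀ l p τ d (N.noise ω) with hR
  set φ : Param n → ℝ := fun x => gradient S.cost x p with hφ
  set ψ : Param n → ℝ := fun x => gradient (S.f l) x p with hψ
  have hYm : Measurable Y := h.measurable_run_noise μ γ θ₀ hN d t
  have hZm : Measurable Z := h.measurable_run_noise μ γ θ₀ hN d τ
  have hφm : Measurable φ := h.measurable_gradient_cost_apply hL p
  have hψm : Measurable ψ := h.measurable_gradient_apply l p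
  have hφG : ∀ x, |φ x| ≤ G := fun x => h.abs_gradient_cost_apply_le hG x p
  have hψG : ∀ x, |ψ x| ≤ G := fun x => (abs_apply_le_norm _ p).trans (h.f_grad l x)
  have hφL : ∀ x y, |φ x - φ y| ≤ L * ‖x - y‖ := fun x y =>
    h.abs_gradient_cost_apply_sub_le hL x y p
  have hψL : ∀ x y, |ψ x - ψ y| ≤ L * ‖x - y‖ := fun x y => by
    simp only [hψ]
    rw [← PiLp.sub_apply]
    exact (abs_apply_le_norm _ p).trans (h.f_smooth l x y)
  have hRm : MemLp R 2 P := h.memLp_report μ γ θ₀ d hN l p τ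
  have hYZ : MemLp (fun ω => Y ω - Z ω) 2 P :=
    (h.memLp_iter μ γ θ₀ d hN t).sub (h.memLp_iter μ γ θ₀ d hN τ)
  have hYZ1 : Integrable (fun ω => ‖Y ω - Z ω‖) P := (hYZ.integrable (by simp)).norm
  have hYZ2 : Integrable (fun ω => ‖Y ω - Z ω‖ ^ 2) P :=
    hYZ.integrable_norm_pow (p := 2) (by simp)
  have hlag := integral_norm_le_of_integral_sq_le hYZ hb hQ
  have hφ2 : ∀ x, |φ x ^ 2| ≤ G ^ 2 := fun x => by
    rw [abs_pow]; exact pow_le_pow_left₀ (abs_nonneg _) (hφG x) 2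
  have hφψ : ∀ x, |φ x * ψ x| ≤ G * G := fun x => by
    rw [abs_mul]; exact mul_le_mul (hφG x) (hψG x) (abs_nonneg _) hG
  have hφmem : ∀ {X : Ω → Param n}, Measurable X → MemLp (fun ω => φ (X ω)) 2 P := fun hX =>
    MemLp.of_bound (hφm.comp hX).aestronglyMeasurable G (Eventually.of_forall fun ω => hφG _)
  have hiY : Integrable (fun ω => φ (Y ω) * R ω) P := (hφmem hYm).integrable_mul hRm
  have hiZ : Integrable (fun ω => φ (Z ω) * R ω) P := (hφmem hZm).integrable_mul hRm
  -- replace the current gradient by the outdated one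
  have e1 : ∫ ω, φ (Y ω) * R ω ∂P ≤ ∫ ω, φ (Z ω) * R ω ∂P
      + L * (Q + reportBound n σ G) / 2 * b := by
    calc _ ≤ ∫ ω, (φ (Z ω) * R ω
          + L * (1 / (2 * b) * ‖Y ω - Z ω‖ ^ 2 + b / 2 * R ω ^ 2)) ∂P := by
          refine integral_mono hiY (hiZ.fun_add (((hYZ2.const_mul _).fun_add
            (hRm.integrable_sq.const_mul _)).const_mul _)) fun ω => ?_
          have h1 : (φ (Y ω) - φ (Z ω)) * R ω ≤ L * ‖Y ω - Z ω‖ * |R ω| := by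
            refine (le_abs_self _).trans ?_
            rw [abs_mul]
            exact mul_le_mul_of_nonneg_right (hφL _ _) (abs_nonneg _)
          -- The weight `b` in Young's inequality balances a squared lag of order `b²` against a
          -- squared report of order one, so both contribute order `b`.
          have h2 : 1 / (2 * b) * ‖Y ω - Z ω‖ ^ 2 + b / 2 * R ω ^ 2 - ‖Y ω - Z ω‖ * |R ω|
              = 1 / (2 * b) * (‖Y ω - Z ω‖ - b * |R ω|) ^ 2 := by
            rw [← sq_abs (R ω)]; field_simp; ring
          have h3 : 0 ≤ 1 / (2 * b) * (‖Y ω - Z ω‖ - b * |R ω|) ^ 2 := by positivity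
          have h4 := mul_le_mul_of_nonneg_left (sub_nonneg.1 (h2.symm ▸ h3)) hL
          simp only
          linarith
      _ = ∫ ω, φ (Z ω) * R ω ∂P
          + L * (1 / (2 * b) * ∫ ω, ‖Y ω - Z ω‖ ^ 2 ∂P + b / 2 * ∫ ω, R ω ^ 2 ∂P) := by
          rw [integral_add hiZ (((hYZ2.const_mul _).fun_add
            (hRm.integrable_sq.const_mul _)).const_mul _), integral_const_mul,
            integral_add (hYZ2.const_mul _) (hRm.integrable_sq.const_mul _),
            integral_const_mul, integral_const_mul]
      _ ≤ ∫ ω, φ (Z ω) * R ω ∂P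
          + L * (1 / (2 * b) * (Q * b ^ 2) + b / 2 * reportBound n σ G) := by
          gcongr
          exact h.integral_report_sq_le μ γ θ₀ d hN hμ hB l p τ
      _ = _ := by field_simp
  -- At its own query time the report has the correct mean up to the smoothing bias.
  have e2 : ∫ ω, φ (Z ω) * R ω ∂P ≤ (1 / m) * (-∫ ω, φ (Z ω) * ψ (Z ω) ∂P
      + L * μ * gaussMoment n 3 * ∫ ω, |φ (Z ω)| ∂P) := by
    have := (abs_le.1 (h.abs_integral_mul_report_add_le (N := N) (P := P) μ γ θ₀ d hN hL hμ hB l p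
      τ hφm hφG)).2
    rw [mul_add, mul_neg]
    linarith
  have hAi : Integrable (fun ω => |φ (Z ω)|) P :=
    integrable_comp_of_abs_le hZm (φ := fun x => |φ x|) hφm.norm fun x => by
      rw [abs_abs]; exact hφG x
  have hZψ : Integrable (fun ω => φ (Z ω) * ψ (Z ω)) P :=
    integrable_comp_of_abs_le hZm (φ := fun x => φ x * ψ x) (hφm.mul hψm) hφψ
  have hYψ : Integrable (fun ω => φ (Y ω) * ψ (Y ω)) P :=
    integrable_comp_of_abs_le hYm (φ := fun x => φ x * ψ x) (hφm.mul hψm) hφψ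
  have hYφ : Integrable (fun ω => φ (Y ω) ^ 2) P :=
    integrable_comp_of_abs_le hYm (φ := fun x => φ x ^ 2) (hφm.pow_const 2) hφ2
  -- Back from the query time to the current time. The bias, linear in `μ`, is absorbed by Young's
  -- inequality into a quarter of the squared gradient plus a `μ²` term, which leaves enough of the
  -- negative square.
  have e3 : -∫ ω, φ (Z ω) * ψ (Z ω) ∂P + L * μ * gaussMoment n 3 * ∫ ω, |φ (Z ω)| ∂P
      ≤ -∫ ω, φ (Y ω) * ψ (Y ω) ∂P + 1 / 4 * ∫ ω, φ (Y ω) ^ 2 ∂P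
        + (L * gaussMoment n 3) ^ 2 * μ ^ 2 + 2 * G * L * (Q + 1) * b := by
    calc _ = ∫ ω, (-(φ (Z ω) * ψ (Z ω)) + L * μ * gaussMoment n 3 * |φ (Z ω)|) ∂P := by
          rw [integral_add hZψ.fun_neg (hAi.const_mul _), integral_neg, integral_const_mul]
      _ ≤ ∫ ω, (((-(φ (Y ω) * ψ (Y ω)) + 1 / 4 * φ (Y ω) ^ 2)
          + (L * gaussMoment n 3) ^ 2 * μ ^ 2) + 4 * G * L * ‖Y ω - Z ω‖) ∂P := by
          refine integral_mono (hZψ.fun_neg.fun_add (hAi.const_mul _))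
            (((hYψ.fun_neg.fun_add (hYφ.const_mul _)).fun_add (integrable_const _)).fun_add
              (hYZ1.const_mul _)) fun ω => ?_
          have h1 := (abs_le.1 (abs_mul_sub_mul_le (hφG (Y ω)) (hψG (Z ω))
            (hφL (Y ω) (Z ω)) (hψL (Y ω) (Z ω)))).2
          have h2 := (abs_le.1 (abs_mul_sub_mul_le (hφG (Y ω)) (hφG (Z ω))
            (hφL (Y ω) (Z ω)) (hφL (Y ω) (Z ω)))).1
          have h3 : L * μ * gaussMoment n 3 * |φ (Z ω)|
              ≤ 1 / 4 * φ (Z ω) ^ 2 + (L * gaussMoment n 3) ^ 2 * μ ^ 2 := by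
            rw [← sq_abs (φ (Z ω))]
            nlinarith [sq_nonneg (1 / 2 * |φ (Z ω)| - L * μ * gaussMoment n 3)]
          have h4 : 0 ≤ G * L * ‖Y ω - Z ω‖ := by positivity
          simp only
          nlinarith
      _ = -∫ ω, φ (Y ω) * ψ (Y ω) ∂P + 1 / 4 * ∫ ω, φ (Y ω) ^ 2 ∂P
          + (L * gaussMoment n 3) ^ 2 * μ ^ 2 + 4 * G * L * ∫ ω, ‖Y ω - Z ω‖ ∂P := by
          rw [integral_add ((hYψ.fun_neg.fun_add (hYφ.const_mul _)).fun_add (integrable_const _))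
              (hYZ1.const_mul _),
            integral_add (hYψ.fun_neg.fun_add (hYφ.const_mul _)) (integrable_const _),
            integral_add hYψ.fun_neg (hYφ.const_mul _), integral_neg, integral_const_mul,
            integral_const_mul, integral_const_mul]
          simp
      _ ≤ -∫ ω, φ (Y ω) * ψ (Y ω) ∂P + 1 / 4 * ∫ ω, φ (Y ω) ^ 2 ∂P
          + (L * gaussMoment n 3) ^ 2 * μ ^ 2 + 4 * G * L * ((Q + 1) / 2 * b) := by gcongr
      _ = _ := by ring
  have e4 := e2.trans (mul_le_mul_of_nonneg_left e3 (by positivity : (0 : ℝ) ≤ 1 / m))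
  have e5 : L * (Q + reportBound n σ G) / 2 * b ≤ L * (Q + reportBound n σ G) * b := by
    have hQ0 : 0 ≤ Q * b ^ 2 := (integral_nonneg fun _ => by positivity).trans hQ
    have hQ1 : 0 ≤ Q := nonneg_of_mul_nonneg_left hQ0 (by positivity)
    have := reportBound_nonneg n σ G
    have : 0 ≤ L * (Q + reportBound n σ G) * b := by positivity
    linarith
  linarith

end AsyncZO

/-! ### One-step descent of the expected cost -/

namespace AsyncZO

variable {m s B : ℕ} {n : Fin m → ℕ}
  {S : System m n s} {L₀ L σ G : ℝ} {D : ℕ}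
  {Ω : Type u} [MeasurableSpace Ω] {P : Measure Ω} [IsProbabilityMeasure P]
  {N : Inputs m n s B Ω} {μ : ℝ} {γ : Fin m → ℕ → ℝ} (θ₀ : Param n) (d : Delays m)
  {a : ℕ → ℝ} {c₀ c₁ ρ : ℝ} (hN : N.Admissible S D P)

omit [IsProbabilityMeasure P] in
include hN in
theorem System.Regular.measurable_gradient_iter (h : S.Regular L₀ L σ G D) (hL : 0 ≤ L) (t : ℕ)
    (p : Σ i : Fin m, Fin (n i)) :
    Measurable fun ω => gradient S.cost (iter S N μ γ θ₀ d t ω) p :=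
  (h.measurable_gradient_cost_apply hL p).comp (h.measurable_run_noise μ γ θ₀ hN d t)

include hN in
theorem System.Regular.memLp_gradient_iter (h : S.Regular L₀ L σ G D) (hL : 0 ≤ L) (hG : 0 ≤ G)
    (t : ℕ) (p : Σ i : Fin m, Fin (n i)) :
    MemLp (fun ω => gradient S.cost (iter S N μ γ θ₀ d t ω) p) 2 P :=
  MemLp.of_bound (h.measurable_gradient_iter θ₀ d hN hL t p).aestronglyMeasurable G
    (Eventually.of_forall fun _ => h.abs_gradient_cost_apply_le hG _ p)

include hN in
theorem System.Regular.integral_gradient_sq_le (h : S.Regular L₀ L σ G D) (hL : 0 ≤ L)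
    (hG : 0 ≤ G) (t : ℕ) (p : Σ i : Fin m, Fin (n i)) :
    ∫ ω, gradient S.cost (iter S N μ γ θ₀ d t ω) p ^ 2 ∂P ≤ G ^ 2 := by
  calc _ ≤ ∫ _, G ^ 2 ∂P := by
        refine integral_mono (h.memLp_gradient_iter θ₀ d hN hL hG t p).integrable_sq
          (integrable_const _) fun ω => ?_
        simp only
        rw [← sq_abs]
        exact pow_le_pow_left₀ (abs_nonneg _) (h.abs_gradient_cost_apply_le hG _ p) 2
    _ = _ := by simp

include hN in
/-- An agent that updates moves along a descent direction, up to a bias and an error of the order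
of the stepsize. -/
theorem System.Regular.integral_gradient_mul_direction_le (h : S.Regular L₀ L σ G D) (hL : 0 ≤ L)
    (hG : 0 ≤ G) (hγ : SlowStep γ a c₀ c₁ ρ D) (hμ : 0 < μ) (hB : 0 < B)
    (hd : ∀ i l τ, l ∈ S.nrx i → d i l τ ≤ D) {t : ℕ} (p : Σ i : Fin m, Fin (n i))
    (ht : t ∈ S.Tu p.1) :
    ∫ ω, gradient S.cost (iter S N μ γ θ₀ d t ω) p
        * S.direction μ γ θ₀ p t d (N.noise ω) ∂P
      ≤ -(1 / 2) * ∫ ω, gradient S.cost (iter S N μ γ θ₀ d t ω) p ^ 2 ∂P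
        + (L * gaussMoment n 3) ^ 2 * μ ^ 2 + alignBound n L σ G D c₁ ρ (a 0) * a t := by
  have hm : (0 : ℝ) < m := by exact_mod_cast (p.1.pos : 0 < m)
  have hQ := lagBound_nonneg n σ G D c₁ ρ
  have hR := reportBound_nonneg n σ G
  have hat := hγ.pos t
  have ha0 := hγ.pos 0
  have hρ := hγ.ρ_pos
  set φ : Ω → ℝ := fun ω => gradient S.cost (iter S N μ γ θ₀ d t ω) p with hφ
  have hφm : MemLp φ 2 P := h.memLp_gradient_iter θ₀ d hN hL hG t p
  have hφ0 : 0 ≤ ∫ ω, φ ω ^ 2 ∂P := integral_nonneg fun _ => sq_nonneg _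
  have hb0 : 0 ≤ (L * gaussMoment n 3) ^ 2 * μ ^ 2 := by positivity
  have hx : 0 ≤ (G ^ 2 + m ^ 2 * reportBound n σ G) * (ρ / a 0) * a t := by positivity
  have hy : 0 ≤ 2 * G * L * (lagBound n σ G D c₁ ρ + 1) * a t := by positivity
  have hz : 0 ≤ m * (L * (lagBound n σ G D c₁ ρ + reportBound n σ G)) * a t := by positivity
  have hsplit : alignBound n L σ G D c₁ ρ (a 0) * a t
      = 2 * G * L * (lagBound n σ G D c₁ ρ + 1) * a t
        + m * (L * (lagBound n σ G D c₁ ρ + reportBound n σ G)) * a t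
        + (G ^ 2 + m ^ 2 * reportBound n σ G) * (ρ / a 0) * a t := by
    rw [alignBound]; ring
  rw [hsplit]
  change ∫ ω, φ ω * S.direction μ γ θ₀ p t d (N.noise ω) ∂P
    ≤ -(1 / 2) * ∫ ω, φ ω ^ 2 ∂P + _ + _
  -- From time `3D` on, every neighbour's report is present and recent. Earlier the memory may still
  -- be empty, and a crude bound is used.
  by_cases h3 : 3 * D ≤ t
  · have hlast : ∀ l ∈ S.nrx p.1, (memory (S.Tq l) (d p.1 l) t).isSome ∧
        t ≤ stamp (S.Tq l) (d p.1 l) t + 3 * D := fun l hl =>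
      memory_isSome_and_le_stamp (fun τ => hd p.1 l τ hl) (h.query_often l) h3
    have hdir : ∀ ω, φ ω * S.direction μ γ θ₀ p t d (N.noise ω) = ∑ l ∈ S.nrx p.1,
        φ ω * S.report μ γ θ₀ l p (stamp (S.Tq l) (d p.1 l) t) d (N.noise ω) := by
      intro ω
      rw [System.direction, if_pos ht, Finset.mul_sum]
      refine Finset.sum_congr rfl fun l hl => ?_
      rw [if_pos (hlast l hl).1]
    simp_rw [hdir]
    have hri : ∀ l, Integrable (fun ω => φ ω *
        S.report μ γ θ₀ l p (stamp (S.Tq l) (d p.1 l) t) d (N.noise ω)) P :=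
      fun l => hφm.integrable_mul (h.memLp_report μ γ θ₀ d hN l p _)
    rw [integral_finsetSum _ fun l _ => hri l]
    have hψi : ∀ l, Integrable (fun ω => φ ω * gradient (S.f l) (iter S N μ γ θ₀ d t ω) p) P := by
      intro l
      refine hφm.integrable_mul (q := 2) (MemLp.of_bound ((h.measurable_gradient_apply l p).comp
        (h.measurable_run_noise μ γ θ₀ hN d t)).aestronglyMeasurable G
        (Eventually.of_forall fun ω => ?_))
      exact (abs_apply_le_norm _ p).trans (h.f_grad l _)
    -- Over the neighbours, the local gradients rebuild the partial derivative of the cost, so their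
    -- correlations with it add up to the full square.
    have hsum : ∑ l ∈ S.nrx p.1, (1 / (m : ℝ)) *
        ∫ ω, φ ω * gradient (S.f l) (iter S N μ γ θ₀ d t ω) p ∂P = ∫ ω, φ ω ^ 2 ∂P := by
      simp_rw [← integral_const_mul]
      rw [← integral_finsetSum _ fun l _ => (hψi l).const_mul _]
      refine integral_congr_ae (Eventually.of_forall fun ω => ?_)
      have h1 := h.gradient_cost_apply (iter S N μ γ θ₀ d t ω) p
      calc _ = φ ω * ∑ l ∈ S.nrx p.1,
            (1 / (m : ℝ)) * gradient (S.f l) (iter S N μ γ θ₀ d t ω) p := by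
            rw [Finset.mul_sum]
            exact Finset.sum_congr rfl fun l _ => by ring
        _ = φ ω * φ ω := by rw [← h1]
        _ = _ := (sq _).symm
    have hcard : ((S.nrx p.1).card : ℝ) ≤ m := by
      exact_mod_cast (Finset.card_le_univ _).trans (by simp)
    have hcard' : ((S.nrx p.1).card : ℝ) * (1 / m) ≤ 1 := by
      rw [mul_one_div, div_le_one hm]; exact hcard
    set W := 1 / 4 * ∫ ω, φ ω ^ 2 ∂P + (L * gaussMoment n 3) ^ 2 * μ ^ 2
      + 2 * G * L * (lagBound n σ G D c₁ ρ + 1) * a t with hW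
    have hW0 : 0 ≤ W := by positivity
    set V := L * (lagBound n σ G D c₁ ρ + reportBound n σ G) * a t with hV
    have hV0 : 0 ≤ V := by positivity
    calc _ ≤ ∑ l ∈ S.nrx p.1, (-((1 / (m : ℝ)) *
          ∫ ω, φ ω * gradient (S.f l) (iter S N μ γ θ₀ d t ω) p ∂P) + ((1 / m) * W + V)) := by
          refine Finset.sum_le_sum fun l hl => ?_
          have h1 := h.integral_gradient_mul_report_le θ₀ d hN hL hG hμ hB l p hat
            (h.integral_lag_sq_le θ₀ d hN hγ hμ hB (stamp_le (S.Tq l) (d p.1 l) t) (hlast l hl).2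
              fun k hk => hγ.slow t k (by have := (hlast l hl).2; omega))
          refine h1.trans_eq ?_
          rw [hW, hV]; ring
      _ = -∫ ω, φ ω ^ 2 ∂P + (((S.nrx p.1).card * (1 / m)) * W + (S.nrx p.1).card * V) := by
          rw [Finset.sum_add_distrib, Finset.sum_neg_distrib, hsum, Finset.sum_const,
            nsmul_eq_mul]
          ring
      _ ≤ -∫ ω, φ ω ^ 2 ∂P + (1 * W + m * V) := by gcongr
      _ ≤ _ := by
          rw [hW, hV]
          linarith
  · have hs := h.memLp_direction (P := P) μ γ θ₀ d hN p t
    have h1 : ∫ ω, φ ω * S.direction μ γ θ₀ p t d (N.noise ω) ∂P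
        ≤ 1 / 2 * ∫ ω, φ ω ^ 2 ∂P
          + 1 / 2 * ∫ ω, S.direction μ γ θ₀ p t d (N.noise ω) ^ 2 ∂P := by
      rw [← integral_const_mul, ← integral_const_mul, ← integral_add
        (hφm.integrable_sq.const_mul _) (hs.integrable_sq.const_mul _)]
      refine integral_mono (hφm.integrable_mul hs) ((hφm.integrable_sq.const_mul _).fun_add
        (hs.integrable_sq.const_mul _)) fun ω => ?_
      simp only
      nlinarith [sq_nonneg (φ ω - S.direction μ γ θ₀ p t d (N.noise ω))]
    have h2 := h.integral_gradient_sq_le (P := P) (μ := μ) (γ := γ) θ₀ d hN hL hG t p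
    have h4 := h.integral_direction_sq_le (P := P) μ γ θ₀ d hN hμ hB p t
    -- During the first `3D` steps the stepsize is still comparable to `a 0`, so a constant error
    -- counts as one of order `a t`. This accounts for the last term of `alignBound`.
    have h5 : 1 ≤ ρ / a 0 * a t := by
      have := hγ.slow t 0 (by omega)
      rw [div_mul_eq_mul_div, one_le_div ha0]
      exact this
    have h6 : (G ^ 2 + m ^ 2 * reportBound n σ G) * 1
        ≤ (G ^ 2 + m ^ 2 * reportBound n σ G) * (ρ / a 0 * a t) := by gcongr
    have h7 : 0 ≤ (m : ℝ) ^ 2 * reportBound n σ G := by positivity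
    change ∫ ω, φ ω ^ 2 ∂P ≤ G ^ 2 at h2
    linarith

include hN in
theorem System.Regular.integrable_cost_iter (h : S.Regular L₀ L σ G D) (hG : 0 ≤ G) (t : ℕ) :
    Integrable (fun ω => S.cost (iter S N μ γ θ₀ d t ω)) P := by
  have hX := h.memLp_iter (P := P) μ γ θ₀ d hN t
  have h1 : Integrable (fun ω => |S.cost θ₀| + G * ‖iter S N μ γ θ₀ d t ω - θ₀‖) P :=
    (integrable_const _).add
      ((((hX.sub (memLp_const θ₀)).integrable (by simp)).norm).const_mul G)
  refine h1.mono' (h.differentiable_cost.continuous.measurable.comp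
    (h.measurable_run_noise μ γ θ₀ hN d t)).aestronglyMeasurable (Eventually.of_forall fun ω => ?_)
  have h2 := abs_sub_le_of_norm_gradient_le h.differentiable_cost (h.cost_grad hG) θ₀
    (iter S N μ γ θ₀ d t ω)
  have h3 := abs_sub_abs_le_abs_sub (S.cost (iter S N μ γ θ₀ d t ω)) (S.cost θ₀)
  rw [Real.norm_eq_abs]
  linarith

open Classical in
/-- The weighted gradient components that decrease the cost at time `t`. -/
noncomputable def decrease (S : System m n s) (N : Inputs m n s B Ω) (P : Measure Ω) (μ : ℝ)
    (γ : Fin m → ℕ → ℝ) (θ₀ : Param n) (d : Delays m) (t : ℕ) : ℝ :=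
  ∑ p : (Σ i : Fin m, Fin (n i)), if t ∈ S.Tu p.1 then
    γ p.1 t * ∫ ω, gradient S.cost (iter S N μ γ θ₀ d t ω) p ^ 2 ∂P else 0

include hN in
/-- The expected cost decreases up to terms of order `μ² a t` and `(a t)²`. -/
theorem System.Regular.integral_cost_succ_le (h : S.Regular L₀ L σ G D) (hL : 0 ≤ L)
    (hG : 0 ≤ G) (hγ : SlowStep γ a c₀ c₁ ρ D) (hμ : 0 < μ) (hB : 0 < B)
    (hd : ∀ i l τ, l ∈ S.nrx i → d i l τ ≤ D) (t : ℕ) :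
    ∫ ω, S.cost (iter S N μ γ θ₀ d (t + 1) ω) ∂P
      ≤ ∫ ω, S.cost (iter S N μ γ θ₀ d t ω) ∂P - 1 / 2 * decrease S N P μ γ θ₀ d t
        + (biasBound n L c₁ * μ ^ 2 * a t
          + descentBound n L σ G D c₁ ρ (a 0) * a t ^ 2) := by
  classical
  have hat := hγ.pos t
  have hc₁ := hγ.c₁_pos
  have hγ0 : ∀ i, 0 ≤ γ i t := fun i => (mul_pos hγ.c₀_pos hat).le.trans (hγ.lower i t)
  have hA := alignBound_nonneg (n := n) (σ := σ) hγ hL hG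
  have hi : ∀ p, Integrable (fun ω => γ p.1 t * (gradient S.cost (iter S N μ γ θ₀ d t ω) p
      * S.direction μ γ θ₀ p t d (N.noise ω))) P := fun p =>
    ((h.memLp_gradient_iter θ₀ d hN hL hG t p).integrable_mul
      (h.memLp_direction μ γ θ₀ d hN p t)).const_mul _
  have hi2 := h.integrable_norm_iter_sub_sq (P := P) μ γ θ₀ d hN (t + 1) t
  have hic := fun t => h.integrable_cost_iter (P := P) (μ := μ) (γ := γ) θ₀ d hN hG t
  have h1 : ∫ ω, S.cost (iter S N μ γ θ₀ d (t + 1) ω) ∂P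
      ≤ ∫ ω, S.cost (iter S N μ γ θ₀ d t ω) ∂P
        + (∑ p : (Σ i : Fin m, Fin (n i)), γ p.1 t *
            ∫ ω, gradient S.cost (iter S N μ γ θ₀ d t ω) p
              * S.direction μ γ θ₀ p t d (N.noise ω) ∂P)
        + L * ∫ ω, ‖iter S N μ γ θ₀ d (t + 1) ω - iter S N μ γ θ₀ d t ω‖ ^ 2 ∂P := by
    simp_rw [← integral_const_mul]
    rw [← integral_finsetSum _ fun p _ => hi p,
      ← integral_add (hic t) (integrable_finsetSum _ fun p _ => hi p),
      ← integral_add ((hic t).fun_add (integrable_finsetSum _ fun p _ => hi p))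
        (hi2.const_mul L)]
    refine integral_mono (hic (t + 1)) (((hic t).fun_add
      (integrable_finsetSum _ fun p _ => hi p)).fun_add (hi2.const_mul L)) fun ω => ?_
    have h2 := (abs_le.1 (abs_sub_sub_inner_gradient_le h.differentiable_cost hL
      (h.cost_smooth hL) (iter S N μ γ θ₀ d t ω) (iter S N μ γ θ₀ d (t + 1) ω))).2
    have h3 : inner ℝ (gradient S.cost (iter S N μ γ θ₀ d t ω))
        (iter S N μ γ θ₀ d (t + 1) ω - iter S N μ γ θ₀ d t ω)
        = ∑ p : (Σ i : Fin m, Fin (n i)), γ p.1 t *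
          (gradient S.cost (iter S N μ γ θ₀ d t ω) p
            * S.direction μ γ θ₀ p t d (N.noise ω)) := by
      rw [PiLp.inner_apply]
      refine Finset.sum_congr rfl fun p _ => ?_
      rw [PiLp.sub_apply, System.run_succ_apply, add_sub_cancel_left]
      simp only [RCLike.inner_apply, conj_trivial]
      ring
    simp only
    linarith
  have h4 := h.integral_norm_iter_succ_sub_sq_le (P := P) μ γ θ₀ d hN hμ hB t
    (g := c₁ * a t) fun i => hγ.abs_le i t
  -- An idle agent has zero direction; charging the nonnegative error term to it as well keeps the
  -- bound independent of who updates.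
  have h5 : ∑ p : (Σ i : Fin m, Fin (n i)), γ p.1 t *
        ∫ ω, gradient S.cost (iter S N μ γ θ₀ d t ω) p
          * S.direction μ γ θ₀ p t d (N.noise ω) ∂P
      ≤ ∑ p : (Σ i : Fin m, Fin (n i)), (-(1 / 2) * (if t ∈ S.Tu p.1 then
          γ p.1 t * ∫ ω, gradient S.cost (iter S N μ γ θ₀ d t ω) p ^ 2 ∂P else 0)
        + c₁ * a t * ((L * gaussMoment n 3) ^ 2 * μ ^ 2
          + alignBound n L σ G D c₁ ρ (a 0) * a t)) := by
    refine Finset.sum_le_sum fun p _ => ?_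
    have h7 : 0 ≤ (L * gaussMoment n 3) ^ 2 * μ ^ 2
        + alignBound n L σ G D c₁ ρ (a 0) * a t := by positivity
    split_ifs with hp
    · have h6 := h.integral_gradient_mul_direction_le (P := P) θ₀ d hN hL hG hγ hμ hB hd p hp
      have h8 := mul_le_mul_of_nonneg_left h6 (hγ0 p.1)
      have h9 := mul_le_mul_of_nonneg_right (hγ.upper p.1 t) h7
      linarith
    · have h8 : ∀ ω, S.direction μ γ θ₀ p t d (N.noise ω) = 0 := fun ω => by
        rw [System.direction, if_neg hp]
      simp only [h8, mul_zero, integral_zero, zero_add]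
      positivity
  rw [Finset.sum_add_distrib, ← Finset.mul_sum, Finset.sum_const, Finset.card_univ,
    nsmul_eq_mul] at h5
  have h10 := mul_le_mul_of_nonneg_left h4 hL
  unfold decrease biasBound descentBound
  linarith

/-! ### Summation over blocks -/

/-- The factor of the squared stepsize in the descent inequality of a block. -/
noncomputable def blockBound (n : Fin m → ℕ) (L σ G : ℝ) (D : ℕ) (c₀ c₁ ρ a₀ : ℝ) : ℝ :=
  D * descentBound n L σ G D c₁ ρ a₀
    + Fintype.card (Σ i : Fin m, Fin (n i)) * (c₀ * (G * L * (lagBound n σ G D c₁ ρ + 1)))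

theorem blockBound_nonneg (hγ : SlowStep γ a c₀ c₁ ρ D) (hL : 0 ≤ L) (hG : 0 ≤ G) :
    0 ≤ blockBound n L σ G D c₀ c₁ ρ (a 0) := by
  have := descentBound_nonneg (n := n) (σ := σ) hγ hL hG
  have := lagBound_nonneg n σ G D c₁ ρ
  have := hγ.c₀_pos
  unfold blockBound
  positivity

include hN in
/-- In a block of `D` steps all components of the gradient contribute to the decrease. -/
theorem System.Regular.le_sum_decrease (h : S.Regular L₀ L σ G D) (hL : 0 ≤ L)
    (hG : 0 ≤ G) (hγ : SlowStep γ a c₀ c₁ ρ D) (hμ : 0 < μ) (hB : 0 < B) (t : ℕ) :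
    c₀ * a (t + D) * ∫ ω, ‖gradient S.cost (iter S N μ γ θ₀ d t ω)‖ ^ 2 ∂P
      - Fintype.card (Σ i : Fin m, Fin (n i))
        * (c₀ * (G * L * (lagBound n σ G D c₁ ρ + 1))) * a t ^ 2
      ≤ ∑ k ∈ Finset.range D, decrease S N P μ γ θ₀ d (t + k) := by
  classical
  have hat := hγ.pos t
  have hc₀ := hγ.c₀_pos
  have hQ := lagBound_nonneg n σ G D c₁ ρ
  have hsq : ∫ ω, ‖gradient S.cost (iter S N μ γ θ₀ d t ω)‖ ^ 2 ∂P
      = ∑ p, ∫ ω, gradient S.cost (iter S N μ γ θ₀ d t ω) p ^ 2 ∂P := by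
    simp_rw [EuclideanSpace.real_norm_sq_eq]
    exact integral_finsetSum _ fun p _ =>
      (h.memLp_gradient_iter θ₀ d hN hL hG t p).integrable_sq
  have hp : ∀ p : (Σ i : Fin m, Fin (n i)),
      c₀ * a (t + D) * ∫ ω, gradient S.cost (iter S N μ γ θ₀ d t ω) p ^ 2 ∂P
        - c₀ * (G * L * (lagBound n σ G D c₁ ρ + 1)) * a t ^ 2
      ≤ ∑ k ∈ Finset.range D, if t + k ∈ S.Tu p.1 then γ p.1 (t + k) *
          ∫ ω, gradient S.cost (iter S N μ γ θ₀ d (t + k) ω) p ^ 2 ∂P else 0 := by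
    intro p
    obtain ⟨k, hk1, hk2, hk3⟩ := h.update_often p.1 t
    have hγ0 : ∀ k, 0 ≤ γ p.1 k := fun k =>
      (mul_pos hc₀ (hγ.pos k)).le.trans (hγ.lower p.1 k)
    -- All terms are nonnegative, so only one update time `k` of this agent in the block is kept.
    have h1 := Finset.single_le_sum (s := Finset.range D) (f := fun k =>
        if t + k ∈ S.Tu p.1 then γ p.1 (t + k) *
          ∫ ω, gradient S.cost (iter S N μ γ θ₀ d (t + k) ω) p ^ 2 ∂P else 0)
      (fun k _ => by
        split_ifs
        · exact mul_nonneg (hγ0 _) (integral_nonneg fun _ => sq_nonneg _)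
        · exact le_rfl) (Finset.mem_range.2 (by omega : k - t < D))
    simp only at h1
    rw [show t + (k - t) = k by omega, if_pos hk3] at h1
    refine le_trans ?_ h1
    have hlag := integral_norm_le_of_integral_sq_le
      ((h.memLp_iter (P := P) μ γ θ₀ d hN k).sub (h.memLp_iter μ γ θ₀ d hN t)) hat
      (h.integral_lag_sq_le θ₀ d hN hγ hμ hB hk1 (by omega) (b := a t)
        fun j hj => hγ.slow t j (by omega))
    have hI : Integrable (fun ω => ‖iter S N μ γ θ₀ d k ω - iter S N μ γ θ₀ d t ω‖) P :=
      (((h.memLp_iter (P := P) μ γ θ₀ d hN k).sub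
        (h.memLp_iter μ γ θ₀ d hN t)).integrable (by simp)).norm
    have hgi := fun t => (h.memLp_gradient_iter (P := P) (μ := μ) (γ := γ)
      θ₀ d hN hL hG t p).integrable_sq
    -- The agents update at different times `k`, so each component is transported to the common time
    -- `t`, the start of the block, at a cost of order `a t`.
    have h2 : ∫ ω, gradient S.cost (iter S N μ γ θ₀ d t ω) p ^ 2 ∂P
        ≤ ∫ ω, gradient S.cost (iter S N μ γ θ₀ d k ω) p ^ 2 ∂P
          + 2 * G * L * ((lagBound n σ G D c₁ ρ + 1) / 2 * a t) := by
      calc _ ≤ ∫ ω, (gradient S.cost (iter S N μ γ θ₀ d k ω) p ^ 2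
            + 2 * G * L * ‖iter S N μ γ θ₀ d k ω - iter S N μ γ θ₀ d t ω‖) ∂P := by
            refine integral_mono (hgi t) ((hgi k).fun_add (hI.const_mul _)) fun ω => ?_
            have hl := h.abs_gradient_cost_apply_sub_le hL (iter S N μ γ θ₀ d k ω)
              (iter S N μ γ θ₀ d t ω) p
            have := (abs_le.1 (abs_mul_sub_mul_le
              (h.abs_gradient_cost_apply_le hG (iter S N μ γ θ₀ d k ω) p)
              (h.abs_gradient_cost_apply_le hG (iter S N μ γ θ₀ d t ω) p) hl hl)).1
            simp only
            linarith
        _ = ∫ ω, gradient S.cost (iter S N μ γ θ₀ d k ω) p ^ 2 ∂P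
            + 2 * G * L * ∫ ω, ‖iter S N μ γ θ₀ d k ω - iter S N μ γ θ₀ d t ω‖ ∂P := by
            rw [integral_add (hgi k) (hI.const_mul _), integral_const_mul]
        _ ≤ _ := by gcongr; exact hlag
    have h3 : c₀ * a (t + D) ≤ γ p.1 k :=
      (mul_le_mul_of_nonneg_left (hγ.anti (by omega)) hc₀.le).trans (hγ.lower p.1 k)
    have h4 : 0 ≤ ∫ ω, gradient S.cost (iter S N μ γ θ₀ d k ω) p ^ 2 ∂P :=
      integral_nonneg fun _ => sq_nonneg _
    have h5 := mul_le_mul_of_nonneg_right h3 h4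
    have h6 : 0 ≤ c₀ * a (t + D) := (mul_pos hc₀ (hγ.pos _)).le
    have h7 := mul_le_mul_of_nonneg_left h2 h6
    have h8 : c₀ * a (t + D) * (G * L * (lagBound n σ G D c₁ ρ + 1) * a t)
        ≤ c₀ * a t * (G * L * (lagBound n σ G D c₁ ρ + 1) * a t) := by
      have : a (t + D) ≤ a t := hγ.anti (by omega)
      gcongr
    linarith
  unfold decrease
  rw [Finset.sum_comm, hsq, Finset.mul_sum]
  refine le_trans (le_of_eq ?_) (Finset.sum_le_sum fun p _ => hp p)
  rw [Finset.sum_sub_distrib, Finset.sum_const, Finset.card_univ, nsmul_eq_mul]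
  ring

-- The one-step inequalities are added up, with all error terms bounded by those of the largest
-- stepsize `a t`, while the decrease carries the smallest weight `a (t + D)`.
include hN in
theorem System.Regular.integral_cost_block_le (h : S.Regular L₀ L σ G D) (hL : 0 ≤ L)
    (hG : 0 ≤ G) (hγ : SlowStep γ a c₀ c₁ ρ D) (hμ : 0 < μ) (hB : 0 < B)
    (hd : ∀ i l τ, l ∈ S.nrx i → d i l τ ≤ D) (t : ℕ) :
    ∫ ω, S.cost (iter S N μ γ θ₀ d (t + D) ω) ∂P
      ≤ ∫ ω, S.cost (iter S N μ γ θ₀ d t ω) ∂P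
        - c₀ / 2 * (a (t + D) * ∫ ω, ‖gradient S.cost (iter S N μ γ θ₀ d t ω)‖ ^ 2 ∂P)
        + (D * biasBound n L c₁ * μ ^ 2 * a t
          + blockBound n L σ G D c₀ c₁ ρ (a 0) * a t ^ 2) := by
  have hat := hγ.pos t
  have hbb := biasBound_nonneg (n := n) hγ L
  have hdb := descentBound_nonneg (n := n) (σ := σ) hγ hL hG
  have key : ∀ j, ∫ ω, S.cost (iter S N μ γ θ₀ d (t + j) ω) ∂P
      ≤ ∫ ω, S.cost (iter S N μ γ θ₀ d t ω) ∂P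
        - 1 / 2 * ∑ k ∈ Finset.range j, decrease S N P μ γ θ₀ d (t + k)
        + j * (biasBound n L c₁ * μ ^ 2 * a t
          + descentBound n L σ G D c₁ ρ (a 0) * a t ^ 2) := by
    intro j
    induction j with
    | zero => simp
    | succ j ih =>
      have h1 := h.integral_cost_succ_le (P := P) θ₀ d hN hL hG hγ hμ hB hd (t + j)
      have h2 : a (t + j) ≤ a t := hγ.anti (by omega)
      have h3 := hγ.pos (t + j)
      have h4 : biasBound n L c₁ * μ ^ 2 * a (t + j)
          + descentBound n L σ G D c₁ ρ (a 0) * a (t + j) ^ 2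
          ≤ biasBound n L c₁ * μ ^ 2 * a t
          + descentBound n L σ G D c₁ ρ (a 0) * a t ^ 2 := by gcongr
      rw [Finset.sum_range_succ]
      push_cast
      rw [← add_assoc]
      linarith
  have h1 := key D
  have h2 := h.le_sum_decrease (P := P) θ₀ d hN hL hG hγ hμ hB t
  -- Only half of this transport error enters the cost inequality; `blockBound` keeps all of it,
  -- which requires its sign.
  have h3 : 0 ≤ Fintype.card (Σ i : Fin m, Fin (n i))
      * (c₀ * (G * L * (lagBound n σ G D c₁ ρ + 1))) * a t ^ 2 := by
    have := hγ.c₀_pos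
    have := lagBound_nonneg n σ G D c₁ ρ
    positivity
  unfold blockBound
  linarith

include hN in
/-- The weighted sum of the expected squared gradients along the beginnings of the blocks. -/
theorem System.Regular.sum_integral_norm_gradient_sq_le (h : S.Regular L₀ L σ G D) (hL : 0 ≤ L)
    (hG : 0 ≤ G) (hγ : SlowStep γ a c₀ c₁ ρ D) (hμ : 0 < μ) (hB : 0 < B)
    (hd : ∀ i l τ, l ∈ S.nrx i → d i l τ ≤ D) {Δ : ℝ} (hΔ : ∀ x, S.cost θ₀ - S.cost x ≤ Δ)
    (K : ℕ) :
    c₀ / 2 * ∑ k ∈ Finset.range K, a ((k + 1) * D)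
        * ∫ ω, ‖gradient S.cost (iter S N μ γ θ₀ d (k * D) ω)‖ ^ 2 ∂P
      ≤ Δ + D * biasBound n L c₁ * μ ^ 2 * ∑ k ∈ Finset.range K, a (k * D)
        + blockBound n L σ G D c₀ c₁ ρ (a 0) * ∑ k ∈ Finset.range K, a (k * D) ^ 2 := by
  have key : ∫ ω, S.cost (iter S N μ γ θ₀ d (K * D) ω) ∂P
      ≤ S.cost θ₀ - c₀ / 2 * ∑ k ∈ Finset.range K, a ((k + 1) * D)
        * ∫ ω, ‖gradient S.cost (iter S N μ γ θ₀ d (k * D) ω)‖ ^ 2 ∂P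
        + D * biasBound n L c₁ * μ ^ 2 * ∑ k ∈ Finset.range K, a (k * D)
        + blockBound n L σ G D c₀ c₁ ρ (a 0) * ∑ k ∈ Finset.range K, a (k * D) ^ 2 := by
    induction K with
    | zero => simp [iter, System.run_zero]
    | succ K ih =>
      have h1 := h.integral_cost_block_le (P := P) θ₀ d hN hL hG hγ hμ hB hd (K * D)
      rw [← Nat.succ_mul] at h1
      rw [Finset.sum_range_succ, Finset.sum_range_succ, Finset.sum_range_succ]
      simp only [Nat.succ_eq_add_one] at h1
      linarith
  have h2 : S.cost θ₀ - Δ ≤ ∫ ω, S.cost (iter S N μ γ θ₀ d (K * D) ω) ∂P := by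
    calc S.cost θ₀ - Δ = ∫ _, (S.cost θ₀ - Δ) ∂P := by simp
      _ ≤ _ := integral_mono (integrable_const _)
          (h.integrable_cost_iter θ₀ d hN hG (K * D)) fun ω => by
            have := hΔ (iter S N μ γ θ₀ d (K * D) ω)
            simp only
            linarith
  linarith

end AsyncZO

namespace AsyncZO

variable {m s B : ℕ} {n : Fin m → ℕ}

/-! ### Stepsizes of order `1 / √t` -/

/-- The value of `ρ` comes from `(t + r) / (k + r) ≤ 1 + 3D / r` for `t ≤ k + 3D`. -/
theorem slowStep_inv_sqrt {c : Fin m → ℝ} {r c₀ c₁ : ℝ} (D : ℕ) (hr : 0 < r) (hc₀ : 0 < c₀)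
    (hc₁ : 0 < c₁) (h₀ : ∀ i, c₀ ≤ c i) (h₁ : ∀ i, c i ≤ c₁) :
    SlowStep (fun i (k : ℕ) => c i / Real.sqrt ((k : ℝ) + r))
      (fun k : ℕ => 1 / Real.sqrt ((k : ℝ) + r)) c₀ c₁ (Real.sqrt (1 + 3 * D / r)) D where
  pos t := by positivity
  anti t k htk := by
    have : (t : ℝ) ≤ k := by exact_mod_cast htk
    simp only
    gcongr
  slow t k htk := by
    have h1 : (t : ℝ) ≤ k + 3 * D := by exact_mod_cast htk
    have hsq : 0 < Real.sqrt ((t : ℝ) + r) := by positivity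
    rw [mul_one_div, div_le_div_iff₀ (by positivity) hsq, one_mul,
      ← Real.sqrt_mul (by positivity)]
    refine Real.sqrt_le_sqrt ?_
    have h2 : (1 + 3 * D / r) * (k + r) = k + r + 3 * D + 3 * D * k / r := by
      field_simp; ring
    have h3 : (0 : ℝ) ≤ 3 * D * k / r := by positivity
    rw [h2]
    linarith
  c₀_pos := hc₀
  c₁_pos := hc₁
  lower i t := by
    rw [mul_one_div]
    gcongr
    exact h₀ i
  upper i t := by
    rw [mul_one_div]
    gcongr
    exact h₁ i

/-- For positive indices the summand is at most `2(√k - √(k - 1))`, which telescopes; the term at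
zero stays separate because `r` may be small. -/
theorem sum_inv_sqrt_le {r : ℝ} (hr : 0 < r) (T : ℕ) :
    ∑ k ∈ Finset.range (T + 1), 1 / Real.sqrt ((k : ℝ) + r)
      ≤ 1 / Real.sqrt r + 2 * Real.sqrt T := by
  induction T with
  | zero => simp
  | succ T ih =>
    rw [Finset.sum_range_succ]
    have h1 : 1 / Real.sqrt (((T + 1 : ℕ) : ℝ) + r) ≤ 1 / Real.sqrt ((T : ℝ) + 1) := by
      push_cast
      exact one_div_le_one_div_of_le (by positivity) (Real.sqrt_le_sqrt (by linarith))
    have h2 : 1 / Real.sqrt ((T : ℝ) + 1) ≤ 2 * (Real.sqrt ((T : ℝ) + 1) - Real.sqrt T) := by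
      have hx : 0 < Real.sqrt ((T : ℝ) + 1) := by positivity
      have hx2 : Real.sqrt ((T : ℝ) + 1) ^ 2 = T + 1 := Real.sq_sqrt (by positivity)
      have hy2 : Real.sqrt (T : ℝ) ^ 2 = T := Real.sq_sqrt (by positivity)
      rw [div_le_iff₀ hx]
      nlinarith [sq_nonneg (Real.sqrt ((T : ℝ) + 1) - Real.sqrt T)]
    push_cast at *
    linarith

theorem sum_inv_le {r : ℝ} (hr : 0 < r) {T : ℕ} :
    ∑ k ∈ Finset.range (T + 1), 1 / ((k : ℝ) + r) ≤ 1 / r + 1 + Real.log T := by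
  rw [Finset.sum_range_succ']
  have h1 : ∑ k ∈ Finset.range T, 1 / (((k + 1 : ℕ) : ℝ) + r) ≤ ((harmonic T : ℚ) : ℝ) := by
    rw [harmonic]
    push_cast
    refine Finset.sum_le_sum fun k _ => ?_
    rw [← one_div]
    exact one_div_le_one_div_of_le (by positivity) (by linarith)
  have h2 := harmonic_le_one_add_log T
  simp only [CharP.cast_eq_zero, zero_add]
  linarith

/-- There are at least `T / D` terms, and for `T ≥ 1` each argument is at most `T + D + r ≤ T (1 + D
+ r)`. -/
theorem sqrt_le_sum_inv_sqrt {r : ℝ} (hr : 0 < r) {D T : ℕ} (hD : 0 < D) (hT : 1 ≤ T) :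
    Real.sqrt T / (D * Real.sqrt (1 + D + r))
      ≤ ∑ k ∈ Finset.range (T / D + 1), 1 / Real.sqrt ((((k + 1) * D : ℕ) : ℝ) + r) := by
  have hT' : (1 : ℝ) ≤ T := by exact_mod_cast hT
  have hD' : (0 : ℝ) < D := by exact_mod_cast hD
  have hsT : 0 < Real.sqrt T := by positivity
  have hterm : ∀ k ∈ Finset.range (T / D + 1), 1 / (Real.sqrt T * Real.sqrt (1 + D + r))
      ≤ 1 / Real.sqrt ((((k + 1) * D : ℕ) : ℝ) + r) := by
    intro k hk
    have h1 : (k + 1) * D ≤ T + D := by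
      have h2 : k ≤ T / D := by simpa [Nat.lt_succ_iff] using hk
      calc (k + 1) * D ≤ (T / D + 1) * D := by gcongr
        _ = T / D * D + D := by ring
        _ ≤ _ := by gcongr; exact Nat.div_mul_le_self T D
    have h3 : (((k + 1) * D : ℕ) : ℝ) ≤ T + D := by exact_mod_cast h1
    rw [← Real.sqrt_mul (by positivity)]
    gcongr
    nlinarith
  have hK : (T : ℝ) / D ≤ ((T / D + 1 : ℕ) : ℝ) := by
    rw [div_le_iff₀ hD']
    have := Nat.lt_div_mul_add (a := T) hD
    have h2 : T ≤ (T / D + 1) * D := by rw [add_mul, one_mul]; omega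
    exact_mod_cast h2
  calc _ = (T : ℝ) / D * (1 / (Real.sqrt T * Real.sqrt (1 + D + r))) := by
        have : (T : ℝ) = Real.sqrt T * Real.sqrt T := (Real.mul_self_sqrt (by positivity)).symm
        nth_rewrite 2 [this]
        field_simp
    _ ≤ ((T / D + 1 : ℕ) : ℝ) * (1 / (Real.sqrt T * Real.sqrt (1 + D + r))) := by gcongr
    _ = ∑ k ∈ Finset.range (T / D + 1), 1 / (Real.sqrt T * Real.sqrt (1 + D + r)) := by
        rw [Finset.sum_const, Finset.card_range, nsmul_eq_mul]
    _ ≤ _ := Finset.sum_le_sum hterm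

/-- Write `log T = 2 log(√T μ²) + 4 log(1/μ)` and use `log x ≤ x - 1`. This removes the logarithm of
`T` from the rate at the price of `log⁺(1/μ)` and a multiple of `μ²`. -/
theorem log_le_mul_sq_add_posLog {T μ : ℝ} (hT : 0 < T) (hμ : 0 < μ) :
    Real.log T ≤ 2 * Real.sqrt T * μ ^ 2 + 4 * Real.posLog μ⁻¹ := by
  have hs : 0 < Real.sqrt T := by positivity
  have h1 := Real.log_le_sub_one_of_pos (by positivity : 0 < Real.sqrt T * μ ^ 2)
  have h2 : Real.log T = 2 * Real.log (Real.sqrt T * μ ^ 2) + 4 * Real.log μ⁻¹ := by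
    rw [Real.log_mul hs.ne' (by positivity), Real.log_sqrt hT.le, Real.log_pow, Real.log_inv]
    push_cast
    ring
  have h3 : Real.log μ⁻¹ ≤ Real.posLog μ⁻¹ := le_max_right _ _
  linarith

theorem sum_range_div_le {a : ℕ → ℝ} (ha : ∀ t, 0 ≤ a t) (hanti : Antitone a) {D : ℕ}
    (hD : 0 < D) (T : ℕ) :
    ∑ k ∈ Finset.range (T / D + 1), a (k * D) ≤ ∑ k ∈ Finset.range (T + 1), a k := by
  refine (Finset.sum_le_sum fun k _ => hanti (Nat.le_mul_of_pos_right k hD)).trans ?_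
  refine Finset.sum_le_sum_of_subset_of_nonneg ?_ fun k _ _ => ha k
  exact Finset.range_subset_range.2 (Nat.succ_le_succ (Nat.div_le_self T D))

/-! ### Random delays -/

section Transfer

variable {S : System m n s} {L₀ L σ G : ℝ} {D : ℕ}
  {Ω : Type u} [MeasurableSpace Ω] {P : Measure Ω} [IsProbabilityMeasure P]
  {N : Inputs m n s B Ω}

/-- Bounds that hold uniformly for fixed delays hold for random delays independent of the noise. -/
theorem Inputs.Admissible.integral_delay_noise_le (hN : N.Admissible S D P)
    {g : Delays m × Noise m n s B → ℝ} (hg : Measurable g) (hg0 : ∀ z, 0 ≤ g z) {c : ℝ}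
    (hint : ∀ ω', Integrable (fun ω => g (N.delay ω', N.noise ω)) P)
    (hc : ∀ ω', ∫ ω, g (N.delay ω', N.noise ω) ∂P ≤ c) :
    Integrable (fun ω => g (N.delay ω, N.noise ω)) P ∧
      ∫ ω, g (N.delay ω, N.noise ω) ∂P ≤ c := by
  obtain ⟨ω₀⟩ : Nonempty Ω := nonempty_of_isProbabilityMeasure P
  have hc0 : 0 ≤ c := (integral_nonneg fun _ => hg0 _).trans (hc ω₀)
  have hmeas : Measurable fun z => ENNReal.ofReal (g z) := ENNReal.measurable_ofReal.comp hg
  have hpair := hN.delay_meas.prodMk hN.measurable_noise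
  -- Lower integrals permit Tonelli before integrability under the joint law is known. The bounds
  -- are needed only at realized delay arrays, which are the ones known to respect the maximal
  -- delay.
  have hlin : ∫⁻ ω, ENNReal.ofReal (g (N.delay ω, N.noise ω)) ∂P ≤ ENNReal.ofReal c := by
    have hind : IndepFun N.delay N.noise P := hN.delay_indep
    have := Measure.isProbabilityMeasure_map (μ := P) hN.delay_meas.aemeasurable
    have := Measure.isProbabilityMeasure_map (μ := P) hN.measurable_noise.aemeasurable
    rw [indepFun_iff_map_prod_eq_prod_map_map hN.delay_meas.aemeasurable
      hN.measurable_noise.aemeasurable] at hind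
    rw [← lintegral_map (f := fun z => ENNReal.ofReal (g z)) hmeas hpair, hind,
      lintegral_prod _ hmeas.aemeasurable, lintegral_map (hmeas.lintegral_prod_right') hN.delay_meas]
    calc _ ≤ ∫⁻ _, ENNReal.ofReal c ∂P := by
          refine lintegral_mono fun ω' => ?_
          have hsec : Measurable fun w => ENNReal.ofReal (g (N.delay ω', w)) :=
            hmeas.comp measurable_prodMk_left
          rw [lintegral_map hsec hN.measurable_noise,
            ← ofReal_integral_eq_lintegral_ofReal (hint ω') (Eventually.of_forall fun _ => hg0 _)]
          exact ENNReal.ofReal_le_ofReal (hc ω')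
      _ = _ := by simp
  have haes : AEStronglyMeasurable (fun ω => g (N.delay ω, N.noise ω)) P :=
    (hg.comp hpair).aestronglyMeasurable
  refine ⟨(lintegral_ofReal_ne_top_iff_integrable haes (Eventually.of_forall fun _ => hg0 _)).1
    (hlin.trans_lt ENNReal.ofReal_lt_top).ne, ?_⟩
  rw [integral_eq_lintegral_of_nonneg_ae (Eventually.of_forall fun _ => hg0 _) haes]
  exact ENNReal.toReal_le_of_le_ofReal hc0 hlin

variable (μ : ℝ) (γ : Fin m → ℕ → ℝ) (θ₀ : Param n)

omit [IsProbabilityMeasure P] in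
theorem System.Regular.measurable_theta (h : S.Regular L₀ L σ G D) (hN : N.Admissible S D P)
    (t : ℕ) : Measurable (theta S N μ γ θ₀ t) :=
  (h.measurable_run μ γ θ₀ t).comp (hN.delay_meas.prodMk hN.measurable_noise)

/-! ### Outdated iterates -/

/-- A bound on the stepsizes of the last `K` steps before time `t`. -/
def stepWindow (γ : Fin m → ℕ → ℝ) (K t : ℕ) : ℝ :=
  ∑ k ∈ Finset.range K, ∑ i, |γ i (t - K + k)|

theorem abs_le_stepWindow {K t k : ℕ} (hK : K ≤ t) (h1 : t ≤ k + K) (h2 : k < t) (i : Fin m) :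
    |γ i k| ≤ stepWindow γ K t := by
  have h3 : |γ i k| ≤ ∑ i, |γ i (t - K + (k - (t - K)))| := by
    -- Here `K ≤ t` matters: the subtraction in the window is then not truncated.
    rw [show t - K + (k - (t - K)) = k by omega]
    exact Finset.single_le_sum (f := fun i => |γ i k|) (fun _ _ => abs_nonneg _)
      (Finset.mem_univ i)
  exact h3.trans (Finset.single_le_sum (f := fun k => ∑ i, |γ i (t - K + k)|)
    (fun _ _ => Finset.sum_nonneg fun _ _ => abs_nonneg _) (Finset.mem_range.2 (by omega)))

theorem tendsto_stepWindow (hγ : ∀ i, Tendsto (γ i) atTop (𝓝 0)) (K : ℕ) :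
    Tendsto (stepWindow γ K) atTop (𝓝 0) := by
  have h1 : ∀ k i, Tendsto (fun t => |γ i (t - K + k)|) atTop (𝓝 0) := by
    intro k i
    have h2 : Tendsto (fun t => t - K + k) atTop atTop :=
      tendsto_atTop_mono (fun t => Nat.le_add_right _ k) (tendsto_sub_atTop_nat K)
    simpa using ((hγ i).comp h2).abs
  have h3 := tendsto_finsetSum (Finset.range K) fun k _ =>
    tendsto_finsetSum (Finset.univ : Finset (Fin m)) fun i _ => h1 k i
  simp only [Finset.sum_const_zero] at h3
  exact h3

/-- Once the delays are frozen the timestamp is a deterministic number, and the increment bound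
applies to it; the result does not depend on the delays. -/
theorem System.Regular.integral_theta_sub_outdated_sq_le (h : S.Regular L₀ L σ G D)
    (hN : N.Admissible S D P) (hμ : 0 < μ) (hB : 0 < B) (l i : Fin m) {K t : ℕ} (hK : K ≤ t)
    (hst : ∀ ω, t ≤ timestamp S N l i t ω + K) :
    Integrable (fun ω => ‖theta S N μ γ θ₀ t ω
      - theta S N μ γ θ₀ (timestamp S N l i t ω) ω‖ ^ 2) P ∧
    ∫ ω, ‖theta S N μ γ θ₀ t ω - theta S N μ γ θ₀ (timestamp S N l i t ω) ω‖ ^ 2 ∂P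
      ≤ (K : ℝ) ^ 2 * (stepWindow γ K t ^ 2 * stepBound n σ G) := by
  have hmeas : Measurable fun z : Delays m × Noise m n s B =>
      ‖S.run μ γ θ₀ t z.1 z.2 - S.run μ γ θ₀ (stamp (S.Tq i) (z.1 l i) t) z.1 z.2‖ ^ 2 :=
    ((h.measurable_run μ γ θ₀ t).sub (measurable_stamp_comp (S.Tq i) t l i
      (g := fun τ z => S.run μ γ θ₀ τ z.1 z.2) fun τ _ =>
        h.measurable_run μ γ θ₀ τ)).norm.pow_const 2
  have hint : ∀ ω', Integrable (fun ω => ‖S.run μ γ θ₀ t (N.delay ω') (N.noise ω)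
      - S.run μ γ θ₀ (stamp (S.Tq i) (N.delay ω' l i) t) (N.delay ω') (N.noise ω)‖ ^ 2) P :=
    fun ω' => h.integrable_norm_iter_sub_sq μ γ θ₀ (N.delay ω') hN t _
  have hle : ∀ ω', ∫ ω, ‖S.run μ γ θ₀ t (N.delay ω') (N.noise ω)
      - S.run μ γ θ₀ (stamp (S.Tq i) (N.delay ω' l i) t) (N.delay ω') (N.noise ω)‖ ^ 2 ∂P
      ≤ (K : ℝ) ^ 2 * (stepWindow γ K t ^ 2 * stepBound n σ G) := by
    intro ω'
    have h1 : t ≤ stamp (S.Tq i) (N.delay ω' l i) t + K := hst ω'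
    exact h.integral_norm_iter_sub_sq_le μ γ θ₀ (N.delay ω') hN hμ hB (stamp_le _ _ _) h1
      fun j k hk1 hk2 => abs_le_stepWindow γ hK (by omega) hk2 j
  exact hN.integral_delay_noise_le hmeas (fun _ => sq_nonneg _) hint hle

theorem System.Regular.integrable_theta_sub_outdated_sq (h : S.Regular L₀ L σ G D)
    (hN : N.Admissible S D P) (hμ : 0 < μ) (hB : 0 < B) (l i : Fin m) (t : ℕ) :
    Integrable (fun ω => ‖theta S N μ γ θ₀ t ω
      - theta S N μ γ θ₀ (timestamp S N l i t ω) ω‖ ^ 2) P :=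
  -- With `K = t` the age condition is void, which covers the times at which the memory may be
  -- empty.
  (h.integral_theta_sub_outdated_sq_le μ γ θ₀ hN hμ hB l i le_rfl fun _ => by omega).1

theorem System.Regular.tendsto_integral_theta_sub_outdated_sq (h : S.Regular L₀ L σ G D)
    (hN : N.Admissible S D P) (hμ : 0 < μ) (hB : 0 < B) (hγ : ∀ i, Tendsto (γ i) atTop (𝓝 0))
    (l i : Fin m) (hi : i ∈ S.nrx l) :
    Tendsto (fun t => ∫ ω, ‖theta S N μ γ θ₀ t ω
      - theta S N μ γ θ₀ (timestamp S N l i t ω) ω‖ ^ 2 ∂P) atTop (𝓝 0) := by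
  have hlim : Tendsto (fun t => ((3 * D : ℕ) : ℝ) ^ 2 *
      (stepWindow γ (3 * D) t ^ 2 * stepBound n σ G)) atTop (𝓝 0) := by
    have := (((tendsto_stepWindow γ hγ (3 * D)).pow 2).mul_const (stepBound n σ G)).const_mul
      (((3 * D : ℕ) : ℝ) ^ 2)
    simpa using this
  refine tendsto_of_tendsto_of_tendsto_of_le_of_le' tendsto_const_nhds hlim
    (Eventually.of_forall fun t => integral_nonneg fun _ => by positivity) ?_
  filter_upwards [eventually_ge_atTop (3 * D)] with t ht
  exact (h.integral_theta_sub_outdated_sq_le μ γ θ₀ hN hμ hB l i ht fun ω =>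
    (memory_isSome_and_le_stamp (fun τ => hN.delay_le ω l i τ hi) (h.query_often i) ht).2).2

omit [MeasurableSpace Ω] in
theorem norm_current_sub_outdated_sq (l : Fin m) (t : ℕ) (ω : Ω) :
    ‖current S N μ γ θ₀ l t ω - outdated S N μ γ θ₀ l t ω‖ ^ 2
      = ∑ i : S.nrx l, ‖theta S N μ γ θ₀ t ω
          - theta S N μ γ θ₀ (timestamp S N l i t ω) ω‖ ^ 2 := by
  rw [PiLp.norm_sq_eq_of_L2]
  rfl

theorem System.Regular.integrable_and_tendsto_cost_sub_outdated (h : S.Regular L₀ L σ G D)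
    (hN : N.Admissible S D P) (hμ : 0 < μ) (hB : 0 < B) (hγ : ∀ i, Tendsto (γ i) atTop (𝓝 0))
    (hL₀ : 0 ≤ L₀) (l i : Fin m) (hi : i ∈ S.nrx l) :
    (∀ t, Integrable (fun ω => |S.f i (theta S N μ γ θ₀ t ω)
      - S.f i (theta S N μ γ θ₀ (timestamp S N l i t ω) ω)|) P) ∧
    Tendsto (fun t => ∫ ω, |S.f i (theta S N μ γ θ₀ t ω)
      - S.f i (theta S N μ γ θ₀ (timestamp S N l i t ω) ω)| ∂P) atTop (𝓝 0) := by
  have hθ := fun t => h.measurable_theta μ γ θ₀ hN t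
  have hθ' : ∀ t, Measurable fun ω => theta S N μ γ θ₀ (timestamp S N l i t ω) ω := fun t =>
    (measurable_stamp_comp (S.Tq i) t l i (g := fun τ z => S.run μ γ θ₀ τ z.1 z.2) fun τ _ =>
      h.measurable_run μ γ θ₀ τ).comp (hN.delay_meas.prodMk hN.measurable_noise)
  set Y : ℕ → Ω → ℝ := fun t ω =>
    ‖theta S N μ γ θ₀ t ω - theta S N μ γ θ₀ (timestamp S N l i t ω) ω‖ with hY
  have hYm : ∀ t, Measurable (Y t) := fun t => ((hθ t).sub (hθ' t)).norm
  have hY2 : ∀ t, MemLp (Y t) 2 P := fun t =>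
    (memLp_two_iff_integrable_sq (hYm t).aestronglyMeasurable).2
      (h.integrable_theta_sub_outdated_sq μ γ θ₀ hN hμ hB l i t)
  have hY1 : ∀ t, Integrable (Y t) P := fun t => (hY2 t).integrable (by simp)
  have hf := (h.f_diff i).continuous.measurable
  have hint : ∀ t, Integrable (fun ω => |S.f i (theta S N μ γ θ₀ t ω)
      - S.f i (theta S N μ γ θ₀ (timestamp S N l i t ω) ω)|) P := fun t => by
    refine ((hY1 t).const_mul L₀).mono'
      ((hf.comp (hθ t)).sub (hf.comp (hθ' t))).norm.aestronglyMeasurable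
      (Eventually.of_forall fun ω => ?_)
    rw [Real.norm_eq_abs, abs_abs]
    exact h.f_lip i _ _
  refine ⟨hint, ?_⟩
  -- The Lipschitz bound and Jensen reduce the cost gap to the root of the mean squared lag.
  have hlim : Tendsto (fun t => L₀ * Real.sqrt (∫ ω, Y t ω ^ 2 ∂P)) atTop (𝓝 0) := by
    have := ((Real.continuous_sqrt.tendsto 0).comp
      (h.tendsto_integral_theta_sub_outdated_sq μ γ θ₀ hN hμ hB hγ l i hi)).const_mul L₀
    simpa using this
  refine tendsto_of_tendsto_of_tendsto_of_le_of_le tendsto_const_nhds hlim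
    (fun t => integral_nonneg fun _ => abs_nonneg _) fun t => ?_
  calc _ ≤ ∫ ω, L₀ * Y t ω ∂P :=
        integral_mono (hint t) ((hY1 t).const_mul L₀) fun ω => h.f_lip i _ _
    _ = L₀ * ∫ ω, Y t ω ∂P := integral_const_mul _ _
    _ ≤ _ := mul_le_mul_of_nonneg_left
        (Real.le_sqrt_of_sq_le (sq_integral_le_integral_sq (hY2 t))) hL₀

/-! ### The rate of convergence -/

theorem System.Regular.integrable_norm_gradient_theta_sq (h : S.Regular L₀ L σ G D)
    (hN : N.Admissible S D P) (hL : 0 ≤ L) (hG : 0 ≤ G) (t : ℕ) :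
    Integrable (fun ω => ‖gradient S.cost (theta S N μ γ θ₀ t ω)‖ ^ 2) P := by
  refine Integrable.of_bound (C := G ^ 2)
    ((((continuous_gradient (h.cost_smooth hL)).measurable.comp
      (h.measurable_theta μ γ θ₀ hN t)).norm.pow_const 2).aestronglyMeasurable)
    (Eventually.of_forall fun ω => ?_)
  rw [norm_pow, norm_norm]
  exact pow_le_pow_left₀ (norm_nonneg _) (h.cost_grad hG _) 2

variable {μ γ} {a : ℕ → ℝ} {c₀ c₁ ρ : ℝ}

/-- The whole weighted sum is transferred at once from frozen to random delays, since the delay-free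
bound is on the sum and not on its terms. -/
theorem System.Regular.sum_integral_norm_gradient_theta_sq_le (h : S.Regular L₀ L σ G D)
    (hN : N.Admissible S D P) (hL : 0 ≤ L) (hG : 0 ≤ G) (hγ : SlowStep γ a c₀ c₁ ρ D)
    (hμ : 0 < μ) (hB : 0 < B) {Δ : ℝ} (hΔ : ∀ x, S.cost θ₀ - S.cost x ≤ Δ) (K : ℕ) :
    c₀ / 2 * ∑ k ∈ Finset.range K, a ((k + 1) * D)
        * ∫ ω, ‖gradient S.cost (theta S N μ γ θ₀ (k * D) ω)‖ ^ 2 ∂P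
      ≤ Δ + D * biasBound n L c₁ * μ ^ 2 * ∑ k ∈ Finset.range K, a (k * D)
        + blockBound n L σ G D c₀ c₁ ρ (a 0) * ∑ k ∈ Finset.range K, a (k * D) ^ 2 := by
  have hgrad := (continuous_gradient (h.cost_smooth hL)).measurable
  have hmeas : Measurable fun z : Delays m × Noise m n s B => c₀ / 2 *
      ∑ k ∈ Finset.range K, a ((k + 1) * D)
        * ‖gradient S.cost (S.run μ γ θ₀ (k * D) z.1 z.2)‖ ^ 2 :=
    measurable_const.mul (Finset.measurable_fun_sum _ fun k _ =>
      measurable_const.mul ((hgrad.comp (h.measurable_run μ γ θ₀ (k * D))).norm.pow_const 2))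
  have hiter : ∀ d k, Integrable (fun ω => ‖gradient S.cost (iter S N μ γ θ₀ d k ω)‖ ^ 2) P := by
    intro d k
    refine Integrable.of_bound (C := G ^ 2)
      (((hgrad.comp (h.measurable_run_noise μ γ θ₀ hN d k)).norm.pow_const 2).aestronglyMeasurable)
      (Eventually.of_forall fun ω => ?_)
    rw [norm_pow, norm_norm]
    exact pow_le_pow_left₀ (norm_nonneg _) (h.cost_grad hG _) 2
  have hsum : ∀ d, Integrable (fun ω => c₀ / 2 * ∑ k ∈ Finset.range K, a ((k + 1) * D)
      * ‖gradient S.cost (iter S N μ γ θ₀ d (k * D) ω)‖ ^ 2) P := fun d =>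
    (integrable_finsetSum _ fun k _ => (hiter d (k * D)).const_mul _).const_mul _
  have hnn : ∀ z : Delays m × Noise m n s B, 0 ≤ c₀ / 2 * ∑ k ∈ Finset.range K, a ((k + 1) * D)
      * ‖gradient S.cost (S.run μ γ θ₀ (k * D) z.1 z.2)‖ ^ 2 := fun z => by
    have := hγ.c₀_pos
    have := fun t => (hγ.pos t).le
    have : 0 ≤ ∑ k ∈ Finset.range K, a ((k + 1) * D)
      * ‖gradient S.cost (S.run μ γ θ₀ (k * D) z.1 z.2)‖ ^ 2 :=
      Finset.sum_nonneg fun k _ => mul_nonneg (this _) (by positivity)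
    positivity
  have key := (hN.integral_delay_noise_le hmeas hnn (fun ω' => hsum (N.delay ω'))
    (c := Δ + D * biasBound n L c₁ * μ ^ 2 * ∑ k ∈ Finset.range K, a (k * D)
        + blockBound n L σ G D c₀ c₁ ρ (a 0) * ∑ k ∈ Finset.range K, a (k * D) ^ 2)
    fun ω' => by
      have h1 := h.sum_integral_norm_gradient_sq_le (P := P) θ₀ (N.delay ω') hN hL hG hγ hμ hB
        (fun i l τ hl => hN.delay_le ω' i l τ hl) hΔ K
      refine le_of_eq_of_le ?_ h1
      rw [integral_const_mul, integral_finsetSum _ fun k _ => (hiter _ (k * D)).const_mul _]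
      simp_rw [integral_const_mul]).2
  refine le_of_eq_of_le ?_ key
  have hθ := fun t => h.integrable_norm_gradient_theta_sq (P := P) μ γ θ₀ hN hL hG t
  have e1 : ∫ ω, c₀ / 2 * ∑ k ∈ Finset.range K, a ((k + 1) * D)
      * ‖gradient S.cost (theta S N μ γ θ₀ (k * D) ω)‖ ^ 2 ∂P
      = c₀ / 2 * ∑ k ∈ Finset.range K, a ((k + 1) * D)
        * ∫ ω, ‖gradient S.cost (theta S N μ γ θ₀ (k * D) ω)‖ ^ 2 ∂P := by
    rw [integral_const_mul, integral_finsetSum _ fun k _ => (hθ (k * D)).const_mul _]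
    simp_rw [integral_const_mul]
  exact e1.symm

end Transfer

/-- From the weighted sum of squared gradients to the rate. -/
theorem le_rate_of_weighted_sum_le {V c₀ κ Δ E F p q μ T : ℝ} (hc₀ : 0 < c₀) (hκ : 0 < κ)
    (hΔ : 0 ≤ Δ) (hF : 0 ≤ F) (hq : 0 ≤ q) (hT : 0 < T) (hμ : 0 < μ)
    (h : c₀ / 2 * (V * (κ * Real.sqrt T)) ≤ Δ + E * μ ^ 2 * (p * Real.sqrt T)
      + F * (q + Real.log T)) :
    V ≤ 2 / (c₀ * κ) * (E * p + 2 * F) * μ ^ 2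
      + 2 / (c₀ * κ) * (Δ + F * q + 4 * F) * (1 + Real.posLog μ⁻¹) / Real.sqrt T := by
  have hs : 0 < Real.sqrt T := Real.sqrt_pos.2 hT
  have hlog := mul_le_mul_of_nonneg_left (log_le_mul_sq_add_posLog hT hμ) hF
  have hpos : 0 ≤ Real.posLog μ⁻¹ := Real.posLog_nonneg
  -- Added only to extract the common factor `1 + log⁺(1/μ)`.
  have h1 : 0 ≤ (Δ + F * q) * Real.posLog μ⁻¹ := by positivity
  have h2 : V * (c₀ * κ / 2 * Real.sqrt T) ≤ (E * p + 2 * F) * μ ^ 2 * Real.sqrt T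
      + (Δ + F * q + 4 * F) * (1 + Real.posLog μ⁻¹) := by
    linarith
  rw [← le_div_iff₀ (by positivity)] at h2
  refine h2.trans_eq ?_
  field_simp

end AsyncZO

/-! ### The convergence theorem -/

theorem theorem2 (m s B D : ℕ) (n : Fin m → ℕ) (hB : 0 < B) (hD : 0 < D) (L₀ L σ G : ℝ) :
    (∀ (S : AsyncZO.System m n s), S.Regular L₀ L σ G D →
      ∀ (Ω : Type u) [MeasurableSpace Ω] (P : Measure Ω) [IsProbabilityMeasure P]
        (N : AsyncZO.Inputs m n s B Ω), N.Admissible S D P →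
      ∀ (μ : ℝ), 0 < μ →
      ∀ (γ : Fin m → ℕ → ℝ), (∀ i t, 0 < γ i t) → (∀ i, Tendsto (γ i) atTop (𝓝 0)) →
      ∀ (θ₀ : AsyncZO.Param n) (l : Fin m),
        ((∀ t, Integrable (fun ω => ‖AsyncZO.current S N μ γ θ₀ l t ω
              - AsyncZO.outdated S N μ γ θ₀ l t ω‖ ^ 2) P) ∧
          Tendsto (fun t => ∫ ω, ‖AsyncZO.current S N μ γ θ₀ l t ω
              - AsyncZO.outdated S N μ γ θ₀ l t ω‖ ^ 2 ∂P) atTop (𝓝 0)) ∧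
        (∀ i ∈ S.nrx l,
          (∀ t, Integrable (fun ω => |S.f i (AsyncZO.theta S N μ γ θ₀ t ω)
              - S.f i (AsyncZO.theta S N μ γ θ₀ (AsyncZO.timestamp S N l i t ω) ω)|) P) ∧
          Tendsto (fun t => ∫ ω, |S.f i (AsyncZO.theta S N μ γ θ₀ t ω)
              - S.f i (AsyncZO.theta S N μ γ θ₀ (AsyncZO.timestamp S N l i t ω) ω)| ∂P)
            atTop (𝓝 0))) ∧
    (∀ (c : Fin m → ℝ) (r Δ : ℝ), (∀ i, 0 < c i) → 0 < r →
      ∃ C₁ C₂ : ℝ, 0 ≤ C₁ ∧ 0 ≤ C₂ ∧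
        ∀ (S : AsyncZO.System m n s), S.Regular L₀ L σ G D →
        ∀ (Ω : Type u) [MeasurableSpace Ω] (P : Measure Ω) [IsProbabilityMeasure P]
          (N : AsyncZO.Inputs m n s B Ω), N.Admissible S D P →
        ∀ (θ₀ : AsyncZO.Param n), (∀ x, S.cost θ₀ - S.cost x ≤ Δ) →
        ∀ (μ : ℝ), 0 < μ →
        ∀ (T : ℕ), 1 ≤ T →
          (∀ t, Integrable (fun ω => ‖gradient S.cost (AsyncZO.theta S N μ
              (fun i k => c i / Real.sqrt ((k : ℝ) + r)) θ₀ t ω)‖ ^ 2) P) ∧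
          (Finset.range (T + 1)).inf' Finset.nonempty_range_add_one
            (fun t => ∫ ω, ‖gradient S.cost (AsyncZO.theta S N μ
              (fun i k => c i / Real.sqrt ((k : ℝ) + r)) θ₀ t ω)‖ ^ 2 ∂P)
            ≤ C₁ * μ ^ 2 + C₂ * (1 + Real.posLog μ⁻¹) / Real.sqrt T) := by
  refine ⟨?_, ?_⟩
  · intro S hS Ω _ P _ N hN μ hμ γ _ hγ θ₀ l
    have h := hS.abs
    refine ⟨⟨fun t => ?_, ?_⟩, fun i hi =>
      h.integrable_and_tendsto_cost_sub_outdated μ γ θ₀ hN hμ hB hγ (abs_nonneg _) l i hi⟩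
    · simp_rw [AsyncZO.norm_current_sub_outdated_sq]
      exact integrable_finsetSum _ fun i _ =>
        h.integrable_theta_sub_outdated_sq μ γ θ₀ hN hμ hB l i t
    · simp_rw [AsyncZO.norm_current_sub_outdated_sq]
      have h1 : ∀ t, ∫ ω, ∑ i : S.nrx l, ‖AsyncZO.theta S N μ γ θ₀ t ω
            - AsyncZO.theta S N μ γ θ₀ (AsyncZO.timestamp S N l i t ω) ω‖ ^ 2 ∂P
          = ∑ i : S.nrx l, ∫ ω, ‖AsyncZO.theta S N μ γ θ₀ t ω
            - AsyncZO.theta S N μ γ θ₀ (AsyncZO.timestamp S N l i t ω) ω‖ ^ 2 ∂P := fun t =>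
        integral_finsetSum _ fun i _ =>
          h.integrable_theta_sub_outdated_sq μ γ θ₀ hN hμ hB l i t
      simp_rw [h1]
      have h2 := tendsto_finsetSum (Finset.univ : Finset (S.nrx l)) fun i _ =>
        h.tendsto_integral_theta_sub_outdated_sq μ γ θ₀ hN hμ hB hγ l i i.2
      simpa using h2
  · intro c r Δ hc hr
    -- Without agents there is no extremal `c i`, and any positive number will do.
    obtain ⟨c₀, hc₀, hc₀c⟩ : ∃ c₀ : ℝ, 0 < c₀ ∧ ∀ i, c₀ ≤ c i := by
      rcases isEmpty_or_nonempty (Fin m) with hm | hm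
      · exact ⟨1, one_pos, fun i => hm.elim i⟩
      · obtain ⟨i, hi⟩ := Finite.exists_min c
        exact ⟨c i, hc i, hi⟩
    obtain ⟨c₁, hc₁, hc₁c⟩ : ∃ c₁ : ℝ, 0 < c₁ ∧ ∀ i, c i ≤ c₁ := by
      rcases isEmpty_or_nonempty (Fin m) with hm | hm
      · exact ⟨1, one_pos, fun i => hm.elim i⟩
      · obtain ⟨i, hi⟩ := Finite.exists_max c
        exact ⟨c i, hc i, hi⟩
    have hγ := AsyncZO.slowStep_inv_sqrt D hr hc₀ hc₁ hc₀c hc₁c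
    set a : ℕ → ℝ := fun k => 1 / Real.sqrt ((k : ℝ) + r) with ha
    set ρ := Real.sqrt (1 + 3 * D / r) with hρ
    set κ := 1 / ((D : ℝ) * Real.sqrt (1 + D + r)) with hκ
    set E := D * AsyncZO.biasBound n |L| c₁ with hE
    set F := AsyncZO.blockBound n |L| σ |G| D c₀ c₁ ρ (a 0) with hF
    have hD' : (0 : ℝ) < D := by exact_mod_cast hD
    have hκ0 : 0 < κ := by positivity
    have hE0 : 0 ≤ E := mul_nonneg hD'.le (AsyncZO.biasBound_nonneg hγ _)
    have hF0 : 0 ≤ F :=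
      AsyncZO.blockBound_nonneg hγ (abs_nonneg L) (abs_nonneg G)
    -- These are the constants of `le_rate_of_weighted_sum_le` with `p = 1/√r + 2` and `q = 1/r +
    -- 1`. They are fixed before the system, so `|Δ|` replaces `Δ` to make the second one
    -- nonnegative.
    refine ⟨2 / (c₀ * κ) * (E * (1 / Real.sqrt r + 2) + 2 * F),
      2 / (c₀ * κ) * (|Δ| + F * (1 / r + 1) + 4 * F), by positivity, by positivity, ?_⟩
    intro S hS Ω _ P _ N hN θ₀ hΔ μ hμ T hT
    have h := hS.abs
    refine ⟨fun t => h.integrable_norm_gradient_theta_sq _ _ θ₀ hN (abs_nonneg _)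
      (abs_nonneg _) t, ?_⟩
    have hT' : (1 : ℝ) ≤ T := by exact_mod_cast hT
    set g : ℕ → ℝ := fun t => ∫ ω, ‖gradient S.cost (AsyncZO.theta S N μ
      (fun i k => c i / Real.sqrt ((k : ℝ) + r)) θ₀ t ω)‖ ^ 2 ∂P with hg
    set V := (Finset.range (T + 1)).inf' Finset.nonempty_range_add_one g with hV
    have hV0 : 0 ≤ V := Finset.le_inf' _ _ fun t _ => integral_nonneg fun _ => by positivity
    -- The block starts `k * D` with `k ≤ T / D` lie in the range of the minimum, so it is at most
    -- each of their values.
    have hVg : ∀ k ∈ Finset.range (T / D + 1), V ≤ g (k * D) := by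
      intro k hk
      refine Finset.inf'_le _ ?_
      rw [Finset.mem_range] at hk ⊢
      have := (Nat.mul_le_mul_right D (Nat.lt_succ_iff.1 hk)).trans (Nat.div_mul_le_self T D)
      omega
    have hsum := h.sum_integral_norm_gradient_theta_sq_le (P := P) θ₀ hN (abs_nonneg _)
      (abs_nonneg _) hγ hμ hB (fun x => (hΔ x).trans (le_abs_self Δ)) (T / D + 1)
    refine AsyncZO.le_rate_of_weighted_sum_le hc₀ hκ0 (abs_nonneg Δ) hF0 (by positivity)
      (by linarith) hμ ?_
    have hs1 : ∑ k ∈ Finset.range (T / D + 1), a (k * D)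
        ≤ (1 / Real.sqrt r + 2) * Real.sqrt T := by
      have h1 := (AsyncZO.sum_range_div_le (fun t => (hγ.pos t).le) hγ.anti hD T).trans
        (AsyncZO.sum_inv_sqrt_le hr T)
      have h2 : 1 / Real.sqrt r * 1 ≤ 1 / Real.sqrt r * Real.sqrt T := by
        gcongr
        exact Real.one_le_sqrt.2 hT'
      linarith
    have hs2 : ∑ k ∈ Finset.range (T / D + 1), a (k * D) ^ 2 ≤ 1 / r + 1 + Real.log T := by
      have h1 := AsyncZO.sum_range_div_le (a := fun k => a k ^ 2) (fun t => sq_nonneg _)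
        (fun j k hjk => pow_le_pow_left₀ (hγ.pos k).le (hγ.anti hjk) 2) hD T
      have h2 : ∀ k : ℕ, a k ^ 2 = 1 / ((k : ℝ) + r) := fun k => by
        rw [ha]
        simp only
        rw [div_pow, Real.sq_sqrt (by positivity), one_pow]
      simp only [h2] at h1 ⊢
      exact h1.trans (AsyncZO.sum_inv_le hr)
    have hs3 : V * (κ * Real.sqrt T) ≤ ∑ k ∈ Finset.range (T / D + 1), a ((k + 1) * D)
        * g (k * D) := by
      have h1 := AsyncZO.sqrt_le_sum_inv_sqrt hr hD hT
      calc V * (κ * Real.sqrt T) = V * (Real.sqrt T / (D * Real.sqrt (1 + D + r))) := by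
            rw [hκ]; ring
        _ ≤ V * ∑ k ∈ Finset.range (T / D + 1), a ((k + 1) * D) :=
            mul_le_mul_of_nonneg_left h1 hV0
        _ = ∑ k ∈ Finset.range (T / D + 1), a ((k + 1) * D) * V := by
            rw [mul_comm, Finset.sum_mul]
        _ ≤ _ := Finset.sum_le_sum fun k hk =>
            mul_le_mul_of_nonneg_left (hVg k hk) (hγ.pos _).le
    calc c₀ / 2 * (V * (κ * Real.sqrt T)) ≤ _ := mul_le_mul_of_nonneg_left hs3 (by positivity)
      _ ≤ _ := hsum
      _ ≤ _ := by gcongr
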